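/- Let $H$ be a complex Hilbert space. Products of (unbounded) operators are taken on their natural domains, and $\operatorname{Re}A=\frac12(A+A^*)$, $\operatorname{Im}A=\frac1{2i}(A-A^*)$ on $\operatorname{dom}A\cap\operatorname{dom}A^*$. A linear operator $A$ in $H$ is *$m$-accretive* if it is densely defined and closed, $\operatorname{Re}(Au,u)\ge 0$ for all $u\in\operatorname{dom}A$, and $\operatorname{Re}(A^*v,v)\ge0$ for all $v\in\operatorname{dom}A^*$. For $\alpha\in[0,\pi/2)$, it is *$m$-$\alpha$-sectorial* if moreover $|\operatorname{Im}(Au,u)|\le\tan\alpha\,\operatorname{Re}(Au,u)$ for all $u\in\operatorname{dom}A$. For $\alpha\in(0,\pi/2)$, $C_H(\alpha)$ is the set of bounded operators $Z$ on $H$ with $\|Z\sin\alpha\pm i\cos\alpha\, I\|\le1$ (both signs), and $C_H(0)$ is the set of selfadjoint contractions. For an $m$-accretive $B$, $B^{1/2}$ is its $m$-accretive square root, i.e. the closure of the operator $u\mapsto\frac1\pi\int_0^\infty t^{-1/2}B(B+tI)^{-1}u\,dt$, $u\in\operatorname{dom}B$; $B^{*1/2}:=(B^*)^{1/2}$, $B^{-1/2}:=(B^{1/2})^{-1}$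 and $B^{*-1/2}:=(B^{*1/2})^{-1}$. **Theorem.** Let $B$ be an $m$-accretive operator in $H$ having a bounded inverse (defined on all of $H$). Then $B^{1/2}$, $B^{*1/2}$ and $\operatorname{Re}(B^{-1/2})$ are injective. Put $$L:=(\operatorname{Re}(B^{-1/2}))^{-1},\qquad Z:=i\,(\operatorname{Re}(B^{-1/2}))^{-1}\operatorname{Im}(B^{-1/2}).$$ Then $L$ is a positive definite selfadjoint operator ($L=L^*$ and $(Lf,f)\ge c\|f\|^2$ on $\operatorname{dom}L$ for some $c>0$), $Z$ is an everywhere defined contraction, $Z^*\operatorname{dom}L\subseteq\operatorname{dom}L$ and $LZ^*f=-ZLf$ for all $f\in\operatorname{dom}L$, the operators $I\pm Z$ and $I\pm Z^*$ are injective, and the following hold, all equalities of operators including equality of domains. 1. $B=L\big((I+Z)(I-Z^*)\big)^{-1}L=(I+Z)^{-1}L^2(I-Z^*)^{-1}$. 2. $B^{1/2}=(I+Z)^{-1}L=L(I-Z^*)^{-1}$ and $B^{*1/2}=(I-Z)^{-1}L=L(I+Z^*)^{-1}$. 3. The operator $B^{1/2}B^{*-1/2}$ is $m$-accretive, and $B^{1/2}B^{*-1/2}=(I-Z)(I+Z)^{-1}$.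 4. For every $\alpha\in[0,\pi/2)$ the following are equivalent: (i) $B$ is $m$-$\alpha$-sectorial; (ii) $B^{1/2}B^{*-1/2}$ is $m$-$\alpha$-sectorial; (iii) $Z\in C_H(\alpha)$. -/

import Mathlib

/-! Unbounded operators in a complex Hilbert space `H` are partial linear maps `H →ₗ.[ℂ] H`.
The inner product `(f, g)`, linear in `f`, is `inner ℂ g f`. -/

noncomputable section

namespace AccretiveSqrt

open MeasureTheory

variable {H : Type*} [NormedAddCommGroup H] [InnerProductSpace ℂ H] [CompleteSpace H]

/-- A bounded operator, regarded as a partial linear map with domain all of `H`. -/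
def bdd (Z : H →L[ℂ] H) : H →ₗ.[ℂ] H := (Z : H →ₗ[ℂ] H).toPMap ⊤

/-- The product `A B` with its natural domain `{x ∈ dom B | B x ∈ dom A}`. -/
def comp (A B : H →ₗ.[ℂ] H) : H →ₗ.[ℂ] H where
  domain :=
    { carrier := {x | ∃ h : x ∈ B.domain, B ⟨x, h⟩ ∈ A.domain}
      zero_mem' := ⟨B.domain.zero_mem, by
        have h : B ⟨0, B.domain.zero_mem⟩ = 0 := B.map_zero
        rw [h]; exact A.domain.zero_mem⟩
      add_mem' := by
        rintro x y ⟨hx, hx'⟩ ⟨hy, hy'⟩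
        refine ⟨B.domain.add_mem hx hy, ?_⟩
        have h : B ⟨x + y, B.domain.add_mem hx hy⟩ = B ⟨x, hx⟩ + B ⟨y, hy⟩ :=
          B.map_add ⟨x, hx⟩ ⟨y, hy⟩
        rw [h]; exact A.domain.add_mem hx' hy'
      smul_mem' := by
        rintro c x ⟨hx, hx'⟩
        refine ⟨B.domain.smul_mem c hx, ?_⟩
        have h : B ⟨c • x, B.domain.smul_mem c hx⟩ = c • B ⟨x, hx⟩ := B.map_smul c ⟨x, hx⟩
        rw [h]; exact A.domain.smul_mem c hx' }
  toFun :=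
    { toFun := fun x => A ⟨B ⟨x, x.2.fst⟩, x.2.snd⟩
      map_add' := by
        intro x y
        rw [← A.map_add]
        congr 1
        exact Subtype.ext (B.map_add ⟨x, x.2.fst⟩ ⟨y, y.2.fst⟩)
      map_smul' := by
        intro c x
        rw [RingHom.id_apply, ← A.map_smul]
        congr 1
        exact Subtype.ext (B.map_smul c ⟨x, x.2.fst⟩) }

/-- The value `A x` for `x ∈ dom A` (and `0` otherwise). -/
def app (A : H →ₗ.[ℂ] H) (x : H) : H :=
  open scoped Classical in if h : x ∈ A.domain then A ⟨x, h⟩ else 0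

/-- `Re A = (A + A*) / 2` with domain `dom A ∩ dom A*`. -/
def re (A : H →ₗ.[ℂ] H) : H →ₗ.[ℂ] H := (1 / 2 : ℂ) • (A + A.adjoint)

/-- `Im A = (A - A*) / (2i)` with domain `dom A ∩ dom A*`. -/
def im (A : H →ₗ.[ℂ] H) : H →ₗ.[ℂ] H := (1 / (2 * Complex.I)) • (A - A.adjoint)

/-- `A` is accretive: `Re (A u, u) ≥ 0` for all `u ∈ dom A`. -/
def IsAccretive (A : H →ₗ.[ℂ] H) : Prop :=
  ∀ u : A.domain, 0 ≤ (inner ℂ (u : H) (A u)).re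

/-- `A` is m-accretive: it is accretive, densely defined and closed, and `A*` is accretive. -/
def IsMAccretive (A : H →ₗ.[ℂ] H) : Prop :=
  IsAccretive A ∧ Dense (A.domain : Set H) ∧ A.IsClosed ∧ IsAccretive A.adjoint

/-- `A` is m-`α`-sectorial (vertex `0`, semi-angle `α ∈ [0, π/2)`): it is m-accretive and
`|Im (A u, u)| ≤ tan α * Re (A u, u)` for all `u ∈ dom A`. -/
def IsMSectorial (α : ℝ) (A : H →ₗ.[ℂ] H) : Prop :=
  IsMAccretive A ∧
    ∀ u : A.domain, |(inner ℂ (u : H) (A u)).im| ≤ Real.tan α * (inner ℂ (u : H) (A u)).re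

/-- `A` maps `dom A` bijectively onto `H` and its inverse is a bounded operator. -/
def HasBoundedInverse (A : H →ₗ.[ℂ] H) : Prop :=
  ∃ R : H →L[ℂ] H, (∀ u : A.domain, R (A u) = u) ∧
    ∀ x : H, ∃ h : R x ∈ A.domain, A ⟨R x, h⟩ = x

/-- `A` is a positive definite selfadjoint operator: `A* = A` and `(A f, f) ≥ c ‖f‖²` on `dom A`
for some `c > 0`. -/
def IsPosDefSelfAdjoint (A : H →ₗ.[ℂ] H) : Prop :=
  IsSelfAdjoint A ∧ ∃ c : ℝ, 0 < c ∧ ∀ f : A.domain, c * ‖(f : H)‖ ^ 2 ≤ (inner ℂ (f : H) (A f)).re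

/-- The class `C_H(α)`, `α ∈ [0, π/2)`: for `α > 0` it is given by `‖Z sin α ± i cos α I‖ ≤ 1`, and
`C_H(0)` is the set of all selfadjoint contractions. -/
def ClassC (α : ℝ) (Z : H →L[ℂ] H) : Prop :=
  if α = 0 then IsSelfAdjoint Z ∧ ‖Z‖ ≤ 1
  else
    ‖(Real.sin α : ℂ) • Z + (Complex.I * (Real.cos α : ℂ)) • (1 : H →L[ℂ] H)‖ ≤ 1 ∧
    ‖(Real.sin α : ℂ) • Z - (Complex.I * (Real.cos α : ℂ)) • (1 : H →L[ℂ] H)‖ ≤ 1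

/-- The integral
`(sin (γ π) / π) ∫_0^∞ t^(γ - 1) B (B + t I)⁻¹ u dt` which is `B^γ u` for `u ∈ dom B`. -/
def balakrishnan (γ : ℝ) (B : H →ₗ.[ℂ] H) (u : H) : H :=
  ((Real.sin (γ * Real.pi) / Real.pi : ℝ) : ℂ) •
    ∫ t in Set.Ioi (0 : ℝ), ((t ^ (γ - 1) : ℝ) : ℂ) •
      app (comp B (B + (t : ℂ) • bdd (1 : H →L[ℂ] H)).inverse) u

/-- The fractional power `B^γ`, `γ ∈ (0, 1)`, of an m-accretive operator: the closure of the
operator given on `dom B` by the Balakrishnan integral (`dom B` is a core of `B^γ`).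
For m-accretive `B` the set of pairs below is already a linear subspace of `H × H`. -/
def fracPow (γ : ℝ) (B : H →ₗ.[ℂ] H) : H →ₗ.[ℂ] H :=
  (Submodule.span ℂ {p : H × H | p.1 ∈ B.domain ∧
    p.2 = balakrishnan γ B p.1}).topologicalClosure.toLinearPMap

/-- The m-accretive square root `B^(1/2)` of an m-accretive operator `B`. -/
def sqrt (B : H →ₗ.[ℂ] H) : H →ₗ.[ℂ] H := fracPow (1 / 2) B

/-- `A` has trivial kernel. For such `A` the partial map `A.inverse` is the inverse of `A`, with
domain the range of `A`. -/
def Inj (A : H →ₗ.[ℂ] H) : Prop := LinearMap.ker A.toFun = ⊥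

/-- `𝓛 = (Re (B^(-1/2)))⁻¹`. -/
def opL (B : H →ₗ.[ℂ] H) : H →ₗ.[ℂ] H := (re (sqrt B).inverse).inverse

/-- `i (Re (B^(-1/2)))⁻¹ (Im (B^(-1/2)))`, with its natural domain. -/
def opZ (B : H →ₗ.[ℂ] H) : H →ₗ.[ℂ] H :=
  Complex.I • comp (re (sqrt B).inverse).inverse (im (sqrt B).inverse)

end AccretiveSqrt

end

noncomputable section

namespace AccretiveSqrt

open MeasureTheory

open ContinuousLinearMap (adjoint)

set_option linter.unusedSectionVars false

variable {H : Type*} [NormedAddCommGroup H] [InnerProductSpace ℂ H] [CompleteSpace H]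

/-! ### Graphs of partial linear maps -/


/-! Every unbounded operator in the statement is built from bounded injective operators, so
identities between operators reduce to identities between bounded factors, domains included. With R
the inverse of B, B^(1/2) is the inverse of the bounded operator S = `rootOp R`, and S² = R
(`rootOp_mul_self`, `sqrt_inverse_bdd`).

Write S = P + iQ with P = Re S and Q = Im S. Since R = S² is accretive, ‖(S + S*)x‖² − ‖(S − S*)x‖²
= 4 Re (S²x, x) ≥ 0, that is, ‖Qx‖ ≤ ‖Px‖. Hence Q = WP with a contraction W, and Q = PW* by taking
adjoints. For Z = iW* this gives S = P(1 + Z) = (1 − Z*)P and S* = P(1 − Z) = (1 + Z*)P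
(`exists_factorization`). Inverting these products, and the two ways of multiplying S by S, yields
the representations with L the inverse of P.

Cancelling P in S z = S* x shows that B^(1/2) B^(*-1/2) is the Cayley transform of Z, whose form is
‖y‖² − ‖Zy‖² − 2i Im (Zy, y) up to conjugation. The form of B is that of the Cayley transform of Z*,
evaluated on the dense range of P, again up to conjugation. Both sectoriality conditions thus become
the inequality of `classC_iff`, for Z or for Z*, and C_H(α) is stable under adjoints.

The identity S² = R comes from an ODE. Put G(t) for the inverse of B + t and I(a) = ∫ G(l² + a) dl
over l > 0. Integration by parts gives I' = −G(a) I(a) / 2, so (1 + a G(0)) I(a)² is constant in a;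
letting a tend to infinity identifies I(0)². -/

theorem ext_graph {A B : H →ₗ.[ℂ] H} (h : ∀ x y, (x, y) ∈ A.graph ↔ (x, y) ∈ B.graph) : A = B :=
  LinearPMap.eq_of_eq_graph (SetLike.ext fun p => h p.1 p.2)

theorem mem_graph_bdd {Z : H →L[ℂ] H} {x y : H} : (x, y) ∈ (bdd Z).graph ↔ Z x = y := by
  rw [LinearPMap.mem_graph_iff]
  constructor
  · rintro ⟨u, hu, huy⟩
    simp only at hu huy
    rw [← huy, ← hu]; rfl
  · rintro rfl
    exact ⟨⟨x, trivial⟩, rfl, rfl⟩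

theorem mem_graph_iff_exists {A : H →ₗ.[ℂ] H} {x y : H} :
    (x, y) ∈ A.graph ↔ ∃ h : x ∈ A.domain, A ⟨x, h⟩ = y := by
  rw [LinearPMap.mem_graph_iff]
  constructor
  · rintro ⟨⟨u, hu⟩, rfl, huy⟩
    exact ⟨hu, huy⟩
  · rintro ⟨h, hy⟩
    exact ⟨⟨x, h⟩, rfl, hy⟩

theorem mem_graph_comp {A B : H →ₗ.[ℂ] H} {x z : H} :
    (x, z) ∈ (comp A B).graph ↔ ∃ y, (x, y) ∈ B.graph ∧ (y, z) ∈ A.graph := by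
  simp only [mem_graph_iff_exists]
  constructor
  · rintro ⟨⟨h, h'⟩, hz⟩
    exact ⟨_, ⟨h, rfl⟩, h', hz⟩
  · rintro ⟨y, ⟨h, rfl⟩, h', hz⟩
    exact ⟨⟨h, h'⟩, hz⟩

theorem inj_iff {A : H →ₗ.[ℂ] H} : Inj A ↔ ∀ x, (x, 0) ∈ A.graph → x = 0 := by
  rw [Inj, LinearMap.ker_eq_bot']
  simp only [mem_graph_iff_exists]
  constructor
  · rintro h x ⟨hx, hx0⟩
    exact congrArg Subtype.val (h ⟨x, hx⟩ hx0)
  · rintro h ⟨x, hx⟩ hx0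
    exact Subtype.ext (h x ⟨hx, hx0⟩)

theorem inj_bdd {Z : H →L[ℂ] H} : Inj (bdd Z) ↔ Function.Injective Z := by
  rw [inj_iff, injective_iff_map_eq_zero]
  simp only [mem_graph_bdd]

theorem mem_graph_inverse {A : H →ₗ.[ℂ] H} (hA : Inj A) {x y : H} :
    (y, x) ∈ A.inverse.graph ↔ (x, y) ∈ A.graph := by
  rw [LinearPMap.inverse_graph hA]
  constructor
  · rintro ⟨⟨a, b⟩, h, hab⟩
    simp only [LinearEquiv.coe_coe, LinearEquiv.prodComm_apply, Prod.swap_prod_mk,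
      Prod.mk.injEq] at hab
    obtain ⟨rfl, rfl⟩ := hab
    exact h
  · intro h
    exact ⟨(x, y), h, rfl⟩

theorem mem_graph_inverse_bdd {X : H →L[ℂ] H} (hX : Function.Injective X) {x y : H} :
    (x, y) ∈ (bdd X).inverse.graph ↔ X y = x := by
  rw [mem_graph_inverse (inj_bdd.2 hX), mem_graph_bdd]

theorem inj_inverse_bdd {X : H →L[ℂ] H} (hX : Function.Injective X) : Inj (bdd X).inverse := by
  rw [inj_iff]
  intro x hx
  rw [mem_graph_inverse_bdd hX, map_zero] at hx
  exact hx.symm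

theorem inverse_inverse_bdd {X : H →L[ℂ] H} (hX : Function.Injective X) :
    (bdd X).inverse.inverse = bdd X :=
  ext_graph fun x y => by
    rw [mem_graph_inverse (inj_inverse_bdd hX), mem_graph_inverse_bdd hX, mem_graph_bdd]

theorem injective_mul {X Y : H →L[ℂ] H} (hX : Function.Injective X)
    (hY : Function.Injective Y) : Function.Injective (X * Y : H →L[ℂ] H) :=
  hX.comp hY

theorem inverse_bdd_mul {X Y : H →L[ℂ] H} (hX : Function.Injective X)
    (hY : Function.Injective Y) :
    (bdd (X * Y)).inverse = comp (bdd Y).inverse (bdd X).inverse :=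
  ext_graph fun x y => by
    have hXY := injective_mul hX hY
    rw [mem_graph_comp, mem_graph_inverse_bdd hXY]
    simp only [mem_graph_inverse_bdd hX, mem_graph_inverse_bdd hY]
    exact ⟨fun h => ⟨_, h, rfl⟩, fun ⟨_, h, h'⟩ => by rw [← h, ← h']; rfl⟩

theorem denseRange_of_injective_adjoint {X : H →L[ℂ] H} (hX : Function.Injective (adjoint X)) :
    DenseRange X := by
  have h : X.range.topologicalClosure = ⊤ := by
    rw [Submodule.topologicalClosure_eq_top_iff, ContinuousLinearMap.orthogonal_range]
    exact LinearMap.ker_eq_bot.2 hX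
  exact Submodule.dense_iff_topologicalClosure_eq_top.2 h

theorem injective_adjoint_of_denseRange {X : H →L[ℂ] H} (hX : DenseRange X) :
    Function.Injective (adjoint X) := by
  refine LinearMap.ker_eq_bot.1 ?_
  have h : X.range.topologicalClosure = ⊤ :=
    Submodule.dense_iff_topologicalClosure_eq_top.1 hX
  rwa [Submodule.topologicalClosure_eq_top_iff, ContinuousLinearMap.orthogonal_range] at h

/-- If the graph of `A` is `{(X y, Y y)}` with `ran X` dense, then the graph of `A*` consists of
the pairs `(v, w)` with `X* w = Y* v`. -/
theorem mem_graph_adjoint {A : H →ₗ.[ℂ] H} {X Y : H →L[ℂ] H} (hX : DenseRange X)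
    (hA : ∀ x z, (x, z) ∈ A.graph ↔ ∃ y, X y = x ∧ Y y = z) {v w : H} :
    (v, w) ∈ A.adjoint.graph ↔ adjoint X w = adjoint Y v := by
  have hd : Dense (A.domain : Set H) := hX.mono <| by
    rintro _ ⟨y, rfl⟩
    exact LinearPMap.mem_domain_iff.2 ⟨Y y, (hA _ _).2 ⟨y, rfl, rfl⟩⟩
  rw [LinearPMap.adjoint_graph_eq_graph_adjoint hd, Submodule.mem_adjoint_iff]
  constructor
  · intro h
    refine ext_inner_left ℂ fun y => ?_
    have := h _ _ ((hA _ _).2 ⟨y, rfl, rfl⟩)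
    rw [ContinuousLinearMap.adjoint_inner_right, ContinuousLinearMap.adjoint_inner_right]
    exact (sub_eq_zero.1 this).symm
  · rintro h a b hab
    obtain ⟨y, rfl, rfl⟩ := (hA _ _).1 hab
    rw [← ContinuousLinearMap.adjoint_inner_right, ← ContinuousLinearMap.adjoint_inner_right,
      h, sub_self]

theorem adjoint_inverse_bdd {X : H →L[ℂ] H} (hX : Function.Injective X) (hd : DenseRange X) :
    (bdd X).inverse.adjoint = (bdd (adjoint X)).inverse :=
  ext_graph fun v w => by
    rw [mem_graph_adjoint (X := X) (Y := 1) hd (fun x z => ?_),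
      mem_graph_inverse_bdd (injective_adjoint_of_denseRange hd)]
    · rw [← ContinuousLinearMap.star_eq_adjoint 1, star_one]
      rfl
    · rw [mem_graph_inverse_bdd hX]
      simp

theorem adjoint_bdd (X : H →L[ℂ] H) : (bdd X).adjoint = bdd (adjoint X) :=
  ContinuousLinearMap.toPMap_adjoint_eq_adjoint_toPMap_of_dense X (p := ⊤) dense_univ

theorem isAccretive_iff {A : H →ₗ.[ℂ] H} :
    IsAccretive A ↔ ∀ x y, (x, y) ∈ A.graph → 0 ≤ (inner ℂ x y).re := by
  simp only [mem_graph_iff_exists]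
  constructor
  · rintro h x _ ⟨hx, rfl⟩
    exact h ⟨x, hx⟩
  · rintro h ⟨x, hx⟩
    exact h x _ ⟨hx, rfl⟩

/-- Replaces B by a bounded operator, so that its graph becomes an equation between bounded maps. -/
theorem exists_eq_inverse_bdd {B : H →ₗ.[ℂ] H} (h : HasBoundedInverse B) :
    ∃ R : H →L[ℂ] H, Function.Injective R ∧ B = (bdd R).inverse := by
  obtain ⟨R, h1, h2⟩ := h
  have hR : Function.Injective R := by
    rw [injective_iff_map_eq_zero]
    intro x hx
    obtain ⟨h, hx'⟩ := h2 x
    rw [← hx', ← B.map_zero]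
    congr 1
    exact Subtype.ext hx
  refine ⟨R, hR, ext_graph fun x y => ?_⟩
  rw [mem_graph_inverse_bdd hR, mem_graph_iff_exists]
  constructor
  · rintro ⟨h, rfl⟩
    exact h1 ⟨x, h⟩
  · rintro rfl
    exact h2 y

section

/-! ### The square root of a pseudo-resolvent on the half line -/

theorem hasDerivWithinAt_of_norm_le_sq {E : Type*} [NormedAddCommGroup E] [NormedSpace ℝ E]
    {f : ℝ → E} {f' : E} {s : Set ℝ} {t K : ℝ}
    (h : ∀ᶠ u in nhdsWithin t s, ‖f u - f t - (u - t) • f'‖ ≤ K * (u - t) ^ 2) :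
    HasDerivWithinAt f f' s t := by
  rw [hasDerivWithinAt_iff_isLittleO]
  have h1 : (fun u => f u - f t - (u - t) • f') =O[nhdsWithin t s] fun u => (u - t) ^ 2 := by
    refine Asymptotics.IsBigO.of_bound K (h.mono fun u hu => ?_)
    rwa [Real.norm_of_nonneg (sq_nonneg _)]
  refine h1.trans_isLittleO ?_
  have h2 : Filter.Tendsto (fun u : ℝ => u - t) (nhdsWithin t s) (nhds 0) := by
    have : Filter.Tendsto (fun u : ℝ => u - t) (nhds t) (nhds (t - t)) :=
      (continuous_id.sub continuous_const).tendsto t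
    rw [sub_self] at this
    exact this.mono_left nhdsWithin_le_nhds
  have h3 := (Asymptotics.isLittleO_pow_id (𝕜 := ℝ) one_lt_two).comp_tendsto h2
  exact h3

theorem integral_Ioi_inv_one_add_sq_zero :
    ∫ l in Set.Ioi (0 : ℝ), (1 + l ^ 2)⁻¹ = Real.pi / 2 := by
  simp

theorem integral_Ioi_div_sq_add_sq {b : ℝ} (hb : 0 < b) :
    ∫ l in Set.Ioi (0 : ℝ), b / (l ^ 2 + b ^ 2) = Real.pi / 2 := by
  have h := integral_comp_mul_left_Ioi (fun x : ℝ => (1 + x ^ 2)⁻¹) 0 (inv_pos.2 hb)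
  rw [mul_zero, integral_Ioi_inv_one_add_sq_zero, inv_inv, smul_eq_mul] at h
  have h2 : ∀ l : ℝ, b / (l ^ 2 + b ^ 2) = b⁻¹ * (1 + (b⁻¹ * l) ^ 2)⁻¹ := fun l => by
    have : 0 < l ^ 2 + b ^ 2 := by positivity
    field_simp
    rw [add_comm]
  simp only [h2]
  rw [integral_const_mul, h]
  field_simp

theorem integrableOn_div_sq_add_sq {b : ℝ} (hb : 0 < b) :
    IntegrableOn (fun l : ℝ => b / (l ^ 2 + b ^ 2)) (Set.Ioi 0) := by
  -- A non-integrable function has integral 0 by convention, whereas this integral is π/2.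
  by_contra h
  have := integral_Ioi_div_sq_add_sq hb
  rw [integral_undef h] at this
  linarith [Real.pi_pos]

variable {A : Type*} [NormedRing A] [NormedAlgebra ℝ A]

theorem integrableOn_of_norm_le_inv_one_add_sq {f : ℝ → A} (hf : Continuous f) {K : ℝ}
    (hK : ∀ l, ‖f l‖ ≤ K * (1 + l ^ 2)⁻¹) : IntegrableOn f (Set.Ioi 0) :=
  (integrable_inv_one_add_sq.const_mul K).integrableOn.mono' hf.aestronglyMeasurable
    (Filter.Eventually.of_forall hK)

theorem norm_integral_le_of_norm_le_inv_one_add_sq {f : ℝ → A} {K : ℝ}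
    (hK : ∀ l, ‖f l‖ ≤ K * (1 + l ^ 2)⁻¹) :
    ‖∫ l in Set.Ioi (0 : ℝ), f l‖ ≤ K * (Real.pi / 2) := by
  refine (norm_integral_le_of_norm_le (integrable_inv_one_add_sq.const_mul K).integrableOn
    (Filter.Eventually.of_forall hK)).trans_eq ?_
  rw [integral_const_mul, integral_Ioi_inv_one_add_sq_zero]

/-- The resolvent `t ↦ (B + t)⁻¹`, `t ≥ 0`, of an operator with bounded inverse, with a bound. -/
structure IsResolventFamily (G : ℝ → A) (C : ℝ) : Prop where
  nonneg : 0 ≤ C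
  resolvent_eq : ∀ s t, 0 ≤ s → 0 ≤ t → G s - G t = (t - s) • (G s * G t)
  norm_le : ∀ t, 0 ≤ t → ‖G t‖ ≤ C * (1 + t)⁻¹

namespace IsResolventFamily

variable {G : ℝ → A} {C : ℝ} (hG : IsResolventFamily G C)

include hG

theorem norm_le_const {t : ℝ} (ht : 0 ≤ t) : ‖G t‖ ≤ C :=
  (hG.norm_le t ht).trans (mul_le_of_le_one_right hG.nonneg (inv_le_one_of_one_le₀ (by linarith)))

theorem commute {s t : ℝ} (hs : 0 ≤ s) (ht : 0 ≤ t) : Commute (G s) (G t) := by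
  rcases eq_or_ne s t with rfl | hst
  · exact Commute.refl _
  · have h1 := hG.resolvent_eq s t hs ht
    have h2 := hG.resolvent_eq t s ht hs
    have h3 : (t - s) • (G s * G t - G t * G s) = 0 := by
      rw [smul_sub, ← h1, ← neg_sub s t, neg_smul, ← h2]
      abel
    exact sub_eq_zero.1 ((smul_eq_zero.1 h3).resolve_left (sub_ne_zero.2 hst.symm))

theorem norm_mul_le {s t : ℝ} (hs : 0 ≤ s) (ht : 0 ≤ t) : ‖G s * G t‖ ≤ C * C :=
  (_root_.norm_mul_le _ _).trans
    (mul_le_mul (hG.norm_le_const hs) (hG.norm_le_const ht) (norm_nonneg _) hG.nonneg)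

/-- Two uses of the resolvent identity give the exact remainder (u − t)² G(t) G(u) G(t), which is
quadratically small because G is bounded. -/
theorem hasDerivWithinAt {t : ℝ} (ht : 0 ≤ t) :
    HasDerivWithinAt G (-(G t * G t)) (Set.Ici 0) t := by
  refine hasDerivWithinAt_of_norm_le_sq (K := C * C * C) ?_
  filter_upwards [self_mem_nhdsWithin] with u hu
  have hu : 0 ≤ u := hu
  have h : G u - G t - (u - t) • (-(G t * G t)) = ((u - t) ^ 2) • (G t * G u * G t) := by
    rw [hG.resolvent_eq u t hu ht, (hG.commute hu ht).eq]
    have h1 : (t - u) • (G t * G u) - (u - t) • (-(G t * G t)) =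
        (u - t) • (G t * (G t - G u)) := by
      rw [mul_sub, smul_sub, smul_neg, ← neg_sub u t, neg_smul]
      abel
    rw [h1, hG.resolvent_eq t u ht hu, mul_smul_comm, smul_smul, sq, mul_assoc,
      (hG.commute hu ht).eq, ← mul_assoc]
  rw [h, norm_smul, Real.norm_of_nonneg (sq_nonneg _), mul_comm]
  refine mul_le_mul_of_nonneg_right ?_ (sq_nonneg _)
  exact (_root_.norm_mul_le _ _).trans
    (mul_le_mul (hG.norm_mul_le ht hu) (hG.norm_le_const ht) (norm_nonneg _)
      (mul_nonneg hG.nonneg hG.nonneg))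

theorem hasDerivAt {t : ℝ} (ht : 0 < t) : HasDerivAt G (-(G t * G t)) t :=
  (hG.hasDerivWithinAt ht.le).hasDerivAt (Ici_mem_nhds ht)

theorem continuousOn : ContinuousOn G (Set.Ici 0) :=
  fun _ ht => (hG.hasDerivWithinAt ht).continuousWithinAt

theorem continuous_comp_sq_add {a : ℝ} (ha : 0 ≤ a) : Continuous fun l : ℝ => G (l ^ 2 + a) :=
  hG.continuousOn.comp_continuous (by fun_prop) fun l => add_nonneg (sq_nonneg l) ha

theorem norm_comp_sq_add_le {a : ℝ} (ha : 0 ≤ a) (l : ℝ) :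
    ‖G (l ^ 2 + a)‖ ≤ C * (1 + l ^ 2)⁻¹ :=
  (hG.norm_le _ (by positivity)).trans <| mul_le_mul_of_nonneg_left
    (inv_anti₀ (by positivity) (by linarith)) hG.nonneg

theorem norm_mul_comp_sq_add_le {a : ℝ} (ha : 0 ≤ a) (l : ℝ) {X : A} {K : ℝ} (hX : ‖X‖ ≤ K) :
    ‖X * G (l ^ 2 + a)‖ ≤ K * C * (1 + l ^ 2)⁻¹ := by
  rw [mul_assoc]
  exact (_root_.norm_mul_le _ _).trans
    (mul_le_mul hX (hG.norm_comp_sq_add_le ha l) (norm_nonneg _) ((norm_nonneg _).trans hX))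

theorem integrableOn {a : ℝ} (ha : 0 ≤ a) :
    IntegrableOn (fun l : ℝ => G (l ^ 2 + a)) (Set.Ioi 0) :=
  integrableOn_of_norm_le_inv_one_add_sq (hG.continuous_comp_sq_add ha)
    (hG.norm_comp_sq_add_le ha)

theorem integrableOn_mul {a b : ℝ} (ha : 0 ≤ a) (hb : 0 ≤ b) :
    IntegrableOn (fun l : ℝ => G (l ^ 2 + a) * G (l ^ 2 + b)) (Set.Ioi 0) :=
  integrableOn_of_norm_le_inv_one_add_sq
    ((hG.continuous_comp_sq_add ha).mul (hG.continuous_comp_sq_add hb))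
    fun l => hG.norm_mul_comp_sq_add_le hb l (hG.norm_le_const (by positivity))

variable [CompleteSpace A]

/-- Integration by parts. -/
theorem mul_integral_eq {a : ℝ} (ha : 0 ≤ a) :
    G a * ∫ l in Set.Ioi (0 : ℝ), G (l ^ 2 + a) =
      (2 : ℝ) • ∫ l in Set.Ioi (0 : ℝ), G (l ^ 2 + a) * G (l ^ 2 + a) := by
  have hI := (hG.integrableOn ha).const_mul (G a)
  have hJ : IntegrableOn (fun l : ℝ => (2 : ℝ) • (G (l ^ 2 + a) * G (l ^ 2 + a))) (Set.Ioi 0) :=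
    (hG.integrableOn_mul ha ha).smul (2 : ℝ)
  have hc : Continuous fun l : ℝ => l • (G a * G (l ^ 2 + a)) :=
    continuous_id.smul (continuous_const.mul (hG.continuous_comp_sq_add ha))
  have hlim : Filter.Tendsto (fun l : ℝ => l • (G a * G (l ^ 2 + a))) Filter.atTop (nhds 0) := by
    refine squeeze_zero_norm' (a := fun l : ℝ => C * C * l⁻¹) ?_ ?_
    · filter_upwards [Filter.eventually_gt_atTop 0] with l hl
      rw [norm_smul, Real.norm_of_nonneg hl.le]
      refine (mul_le_mul_of_nonneg_left
        (hG.norm_mul_comp_sq_add_le ha l (hG.norm_le_const ha)) hl.le).trans ?_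
      have hCC := mul_nonneg hG.nonneg hG.nonneg
      rw [mul_left_comm]
      refine mul_le_mul_of_nonneg_left ?_ hCC
      rw [← div_eq_mul_inv, div_le_iff₀ (by positivity)]
      field_simp
      linarith
    · simpa using tendsto_inv_atTop_zero.const_mul (C * C)
  -- The function l G(a) G(l² + a) vanishes at 0 and at infinity. As l² G(a) G(l² + a) = G(a) − G(l²
  -- + a), its derivative is 2 G(l² + a)² − G(a) G(l² + a).
  have key := integral_Ioi_of_hasDerivAt_of_tendsto (a := 0)
    (f' := fun l => (2 : ℝ) • (G (l ^ 2 + a) * G (l ^ 2 + a)) - G a * G (l ^ 2 + a))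
    hc.continuousWithinAt (fun l hl => ?_) (hJ.sub hI) hlim
  · rw [integral_sub hJ hI, zero_smul, sub_zero, integral_smul,
      integral_const_mul_of_integrable (hG.integrableOn ha)] at key
    exact (sub_eq_zero.1 key).symm
  · have hl : 0 < l := hl
    have hp : 0 < l ^ 2 + a := by positivity
    have h1 : HasDerivAt (fun l : ℝ => l ^ 2 + a) (2 * l) l := by
      simpa using (hasDerivAt_pow 2 l).add_const a
    have h2 := (hG.hasDerivAt hp).scomp l h1
    have h3 := (hasDerivAt_id l).smul (h2.const_mul (G a))
    refine h3.congr_deriv ?_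
    have h4 := hG.resolvent_eq a _ ha hp.le
    rw [add_sub_cancel_right] at h4
    simp only [id, Function.comp]
    have h5 : l • (G a * (2 * l) • -(G (l ^ 2 + a) * G (l ^ 2 + a))) =
        (-2 : ℝ) • (((l ^ 2) • (G a * G (l ^ 2 + a))) * G (l ^ 2 + a)) := by
      rw [mul_smul_comm, smul_smul, mul_neg, smul_neg, smul_mul_assoc, smul_smul, mul_assoc,
        ← neg_smul]
      congr 1
      ring
    rw [h5, ← h4, sub_mul, smul_sub, one_smul, neg_smul, neg_smul, two_smul ℝ (G a * _)]
    abel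

/-- The remainder of the difference quotient is an explicit triple product; one factor G(l² + a)
makes it integrable in l, so no dominated convergence is needed. -/
theorem hasDerivWithinAt_integral {a : ℝ} (ha : 0 ≤ a) :
    HasDerivWithinAt (fun a => ∫ l in Set.Ioi (0 : ℝ), G (l ^ 2 + a))
      (-∫ l in Set.Ioi (0 : ℝ), G (l ^ 2 + a) * G (l ^ 2 + a)) (Set.Ici 0) a := by
  refine hasDerivWithinAt_of_norm_le_sq (K := C * C * C * (Real.pi / 2)) ?_
  filter_upwards [self_mem_nhdsWithin] with b hb
  have hb : 0 ≤ b := hb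
  have hab : IntegrableOn (fun l : ℝ => G (l ^ 2 + b) - G (l ^ 2 + a)) (Set.Ioi 0) :=
    (hG.integrableOn hb).sub (hG.integrableOn ha)
  have haa : IntegrableOn (fun l : ℝ => (b - a) • (G (l ^ 2 + a) * G (l ^ 2 + a))) (Set.Ioi 0) :=
    (hG.integrableOn_mul ha ha).smul (b - a)
  have h : (∫ l in Set.Ioi (0 : ℝ), G (l ^ 2 + b)) - (∫ l in Set.Ioi (0 : ℝ), G (l ^ 2 + a)) -
      (b - a) • (-∫ l in Set.Ioi (0 : ℝ), G (l ^ 2 + a) * G (l ^ 2 + a)) =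
      ((b - a) ^ 2) •
        ∫ l in Set.Ioi (0 : ℝ), G (l ^ 2 + a) * G (l ^ 2 + b) * G (l ^ 2 + a) := by
    rw [smul_neg, sub_neg_eq_add, ← integral_sub (hG.integrableOn hb) (hG.integrableOn ha),
      ← integral_smul, ← integral_add hab haa, ← integral_smul]
    congr 1
    funext l
    have hpa : 0 ≤ l ^ 2 + a := by positivity
    have hpb : 0 ≤ l ^ 2 + b := by positivity
    have h1 : G (l ^ 2 + b) - G (l ^ 2 + a) = (a - b) • (G (l ^ 2 + a) * G (l ^ 2 + b)) := by
      rw [hG.resolvent_eq _ _ hpb hpa, (hG.commute hpb hpa).eq]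
      congr 1
      ring
    have h2 : G (l ^ 2 + a) - G (l ^ 2 + b) = (b - a) • (G (l ^ 2 + b) * G (l ^ 2 + a)) := by
      rw [← neg_sub, h1, (hG.commute hpb hpa).eq, ← neg_smul, neg_sub]
    have h3 : (a - b) • (G (l ^ 2 + a) * G (l ^ 2 + b)) + (b - a) • (G (l ^ 2 + a) * G (l ^ 2 + a))
        = (b - a) • (G (l ^ 2 + a) * (G (l ^ 2 + a) - G (l ^ 2 + b))) := by
      rw [mul_sub, smul_sub, ← neg_sub b a, neg_smul]
      abel
    rw [h1, h3, h2, mul_smul_comm, smul_smul, ← sq (b - a), mul_assoc]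
  rw [h, norm_smul, Real.norm_of_nonneg (sq_nonneg _), mul_comm]
  refine mul_le_mul_of_nonneg_right ?_ (sq_nonneg _)
  exact norm_integral_le_of_norm_le_inv_one_add_sq fun l =>
    hG.norm_mul_comp_sq_add_le ha l (hG.norm_mul_le (by positivity) (by positivity))

theorem commute_integral {a t : ℝ} (ha : 0 ≤ a) (ht : 0 ≤ t) :
    Commute (G t) (∫ l in Set.Ioi (0 : ℝ), G (l ^ 2 + a)) := by
  rw [Commute, SemiconjBy, ← integral_const_mul_of_integrable (hG.integrableOn ha),
    ← integral_mul_const_of_integrable (hG.integrableOn ha)]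
  congr 1
  funext l
  exact (hG.commute ht (by positivity)).eq

/-- By I' = −G(a) I(a) / 2, the left side has derivative (G(0) − (1 + a G(0)) G(a)) I(a)², and the
bracket vanishes by the resolvent identity. -/
theorem integral_mul_self_add_eq {a : ℝ} (ha : 0 ≤ a) :
    (∫ l in Set.Ioi (0 : ℝ), G (l ^ 2 + a)) * (∫ l in Set.Ioi (0 : ℝ), G (l ^ 2 + a)) +
      a • (G 0 * ((∫ l in Set.Ioi (0 : ℝ), G (l ^ 2 + a)) *
        (∫ l in Set.Ioi (0 : ℝ), G (l ^ 2 + a)))) =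
    (∫ l in Set.Ioi (0 : ℝ), G (l ^ 2 + 0)) * (∫ l in Set.Ioi (0 : ℝ), G (l ^ 2 + 0)) := by
  set I : ℝ → A := fun a => ∫ l in Set.Ioi (0 : ℝ), G (l ^ 2 + a) with hI
  have hd : ∀ x, 0 ≤ x →
      HasDerivWithinAt (fun x => I x * I x + x • (G 0 * (I x * I x))) 0 (Set.Ici 0) x := by
    intro x hx
    have h1 := hG.hasDerivWithinAt_integral hx
    have h2 := hG.mul_integral_eq hx
    have hc := hG.commute_integral hx hx
    set J := ∫ l in Set.Ioi (0 : ℝ), G (l ^ 2 + x) * G (l ^ 2 + x)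
    have hJ : J = (1 / 2 : ℝ) • (G x * I x) := by
      rw [hI, h2, smul_smul]; norm_num
    change HasDerivWithinAt I (-J) (Set.Ici 0) x at h1
    change Commute (G x) (I x) at hc
    have h3 := h1.mul h1
    have h4 := (hasDerivWithinAt_id x (Set.Ici 0)).smul (h3.const_mul (G 0))
    refine (h3.add h4).congr_deriv ?_
    have h5 : -J * I x + I x * -J = -(G x * (I x * I x)) := by
      rw [hJ, neg_mul, mul_neg, smul_mul_assoc, mul_smul_comm, ← mul_assoc (I x), ← hc.eq,
        mul_assoc, ← neg_add, ← add_smul]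
      norm_num
    rw [h5]
    simp only [id, one_smul, Pi.mul_apply]
    have h6 := hG.resolvent_eq 0 x le_rfl hx
    rw [sub_zero] at h6
    have h7 : x • (G 0 * -(G x * (I x * I x))) = -((x • (G 0 * G x)) * (I x * I x)) := by
      rw [mul_neg, smul_neg, smul_mul_assoc, mul_assoc (G 0)]
    rw [h7, ← h6, sub_mul]
    abel
  have key := constant_of_has_deriv_right_zero (a := 0) (b := a)
    (fun x hx => ((hd x hx.1).continuousWithinAt).mono Set.Icc_subset_Ici_self)
    (fun x hx => (hd x hx.1).mono (Set.Ici_subset_Ici.2 hx.1)) a ⟨ha, le_rfl⟩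
  simp only [zero_smul, add_zero] at key
  exact key

/-- Compares b I(b²) with the scalar integral of b / (l² + b²), equal to π/2. The extra factor `G 0`
gives convergence in norm as b grows, since (l² + b²) G(l² + b²) G(0) = G(0) − G(l² + b²). -/
theorem norm_smul_integral_sub_le {b : ℝ} (hb : 0 < b) :
    ‖b • ((∫ l in Set.Ioi (0 : ℝ), G (l ^ 2 + b ^ 2)) * G 0) - (Real.pi / 2) • G 0‖ ≤
      C * (1 + b ^ 2)⁻¹ * (Real.pi / 2) := by
  have hint : IntegrableOn (fun l : ℝ => (b / (l ^ 2 + b ^ 2)) • G 0) (Set.Ioi 0) :=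
    Integrable.smul_const (integrableOn_div_sq_add_sq hb) (G 0)
  have hi := hG.integrableOn (sq_nonneg b)
  have hi' : IntegrableOn (fun l : ℝ => b • (G (l ^ 2 + b ^ 2) * G 0)) (Set.Ioi 0) :=
    (hi.mul_const (G 0)).smul b
  rw [← integral_Ioi_div_sq_add_sq hb, ← integral_smul_const,
    ← integral_mul_const_of_integrable hi, ← integral_smul,
    ← integral_sub hi' hint, ← integral_const_mul]
  refine norm_integral_le_of_norm_le ((integrableOn_div_sq_add_sq hb).const_mul _)
    (Filter.Eventually.of_forall fun l => ?_)
  have hp : 0 < l ^ 2 + b ^ 2 := by positivity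
  have h := hG.resolvent_eq 0 _ le_rfl hp.le
  rw [sub_zero, (hG.commute le_rfl hp.le).eq] at h
  have h2 : b • (G (l ^ 2 + b ^ 2) * G 0) - (b / (l ^ 2 + b ^ 2)) • G 0 =
      (-(b / (l ^ 2 + b ^ 2))) • G (l ^ 2 + b ^ 2) := by
    have h3 : b • (G (l ^ 2 + b ^ 2) * G 0) =
        (b / (l ^ 2 + b ^ 2)) • ((l ^ 2 + b ^ 2) • (G (l ^ 2 + b ^ 2) * G 0)) := by
      rw [smul_smul, div_mul_cancel₀ _ hp.ne']
    rw [h3, ← h, smul_sub, neg_smul]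
    abel
  rw [h2, norm_smul, norm_neg, Real.norm_of_nonneg (by positivity), mul_comm]
  refine mul_le_mul_of_nonneg_right ((hG.norm_le _ hp.le).trans ?_) (by positivity)
  exact mul_le_mul_of_nonneg_left (inv_anti₀ (by positivity) (by nlinarith [sq_nonneg l])) hG.nonneg

theorem integral_mul_self_mul_eq :
    (∫ l in Set.Ioi (0 : ℝ), G (l ^ 2 + 0)) * (∫ l in Set.Ioi (0 : ℝ), G (l ^ 2 + 0)) *
      (G 0 * G 0) = ((Real.pi / 2) ^ 2) • (G 0 * (G 0 * G 0)) := by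
  set I : ℝ → A := fun a => ∫ l in Set.Ioi (0 : ℝ), G (l ^ 2 + a) with hI
  have hT : Filter.Tendsto (fun b : ℝ => b • (I (b ^ 2) * G 0)) Filter.atTop
      (nhds ((Real.pi / 2) • G 0)) := by
    rw [tendsto_iff_norm_sub_tendsto_zero]
    refine squeeze_zero' (g := fun b : ℝ => C * (1 + b ^ 2)⁻¹ * (Real.pi / 2))
      (Filter.Eventually.of_forall fun b => norm_nonneg _) ?_ ?_
    · filter_upwards [Filter.eventually_gt_atTop 0] with b hb
      exact hG.norm_smul_integral_sub_le hb
    · have h1 : Filter.Tendsto (fun b : ℝ => 1 + b ^ 2) Filter.atTop Filter.atTop :=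
        Filter.tendsto_atTop_add_const_left _ _ (Filter.tendsto_pow_atTop two_ne_zero)
      simpa using (h1.inv_tendsto_atTop.const_mul C).mul_const (Real.pi / 2)
  have hT2 := hT.mul hT
  have hinv : Filter.Tendsto (fun b : ℝ => (b ^ 2)⁻¹) Filter.atTop (nhds 0) :=
    (Filter.tendsto_pow_atTop two_ne_zero).inv_tendsto_atTop
  -- For a = b² the constant I(0)² times G(0)² equals (b⁻² + G(0)) (b I(b²) G(0))², whose limit is
  -- now known.
  have hT3 := (hinv.smul hT2).add (hT2.const_mul (G 0))
  refine (tendsto_nhds_unique (tendsto_const_nhds.congr' ?_) hT3).trans ?_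
  · filter_upwards [Filter.eventually_gt_atTop 0] with b hb
    have hc : Commute (G 0) (I (b ^ 2)) := hG.commute_integral (sq_nonneg b) le_rfl
    have key := hG.integral_mul_self_add_eq (sq_nonneg b)
    change I (b ^ 2) * I (b ^ 2) + b ^ 2 • (G 0 * (I (b ^ 2) * I (b ^ 2))) = I 0 * I 0 at key
    have h1 : b • (I (b ^ 2) * G 0) * b • (I (b ^ 2) * G 0) =
        (b ^ 2) • (I (b ^ 2) * I (b ^ 2) * (G 0 * G 0)) := by
      rw [smul_mul_smul_comm, ← sq, hc.symm.mul_mul_mul_comm]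
    rw [h1, smul_smul, inv_mul_cancel₀ (by positivity), one_smul, mul_smul_comm]
    change I 0 * I 0 * (G 0 * G 0) = _
    rw [← key, add_mul, smul_mul_assoc, ← mul_assoc (G 0) _ (G 0 * G 0)]
  · rw [zero_smul, zero_add, smul_mul_smul_comm, mul_smul_comm, sq]

end IsResolventFamily

end

/-! ### The square root of a bounded accretive operator -/

/-- `R (1 + t R)⁻¹`, which is `(B + t)⁻¹` for `B = R⁻¹`. -/
def resolv (R : H →L[ℂ] H) (t : ℝ) : H →L[ℂ] H := R * Ring.inverse (1 + t • R)

/-- The square root of a bounded accretive injective operator `R`, given as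
`(2 / π) ∫_0^∞ R (1 + l² R)⁻¹ dl`. -/
def rootOp (R : H →L[ℂ] H) : H →L[ℂ] H :=
  (2 / Real.pi) • ∫ l in Set.Ioi (0 : ℝ), resolv R (l ^ 2 + 0)

section

variable {R : H →L[ℂ] H}

theorem re_inner_add_smul (x : H) (t : ℝ) :
    (inner ℂ x (x + t • R x)).re = ‖x‖ ^ 2 + t * (inner ℂ x (R x)).re := by
  rw [inner_add_right, ← Complex.coe_smul, inner_smul_right, Complex.add_re,
    Complex.re_ofReal_mul]
  congr 1
  exact inner_self_eq_norm_sq (𝕜 := ℂ) x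

theorem commute_inverse_one_add_smul (R : H →L[ℂ] H) (t : ℝ) :
    Commute R (Ring.inverse (1 + t • R)) := by
  have h : Commute R (1 + t • R) :=
    (Commute.one_right R).add_right ((Commute.refl R).smul_right t)
  -- `Ring.inverse` is 0 at a non-unit, so commutation holds for every real t.
  by_cases hu : IsUnit (1 + t • R)
  · obtain ⟨u, hu⟩ := hu
    rw [← hu] at h ⊢
    rw [Ring.inverse_unit]
    exact h.units_inv_right
  · rw [Ring.inverse_non_unit _ hu]
    exact Commute.zero_right R

variable (hR : ∀ x, 0 ≤ (inner ℂ x (R x)).re)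

include hR

theorem isUnit_one_add_smul {t : ℝ} (ht : 0 ≤ t) : IsUnit (1 + t • R) := by
  refine ContinuousLinearMap.isUnit_of_forall_le_norm_inner_map _ (c := 1) one_pos fun x => ?_
  rw [NNReal.coe_one, mul_one, norm_inner_symm]
  refine le_trans ?_ (Complex.re_le_norm _)
  have h := re_inner_add_smul (R := R) x t
  change _ ≤ (inner ℂ x (x + t • R x)).re
  rw [h]
  linarith [mul_nonneg ht (hR x)]

theorem inverse_add_smul_apply {t : ℝ} (ht : 0 ≤ t) (x : H) :
    Ring.inverse (1 + t • R) x + t • R (Ring.inverse (1 + t • R) x) = x :=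
  DFunLike.congr_fun (Ring.mul_inverse_cancel _ (isUnit_one_add_smul hR ht)) x

theorem norm_inverse_apply_le {t : ℝ} (ht : 0 ≤ t) (x : H) :
    ‖Ring.inverse (1 + t • R) x‖ ≤ ‖x‖ := by
  have h := inverse_add_smul_apply hR ht x
  set w := Ring.inverse (1 + t • R) x
  have h1 := re_inner_add_smul (R := R) w t
  rw [h] at h1
  have h2 := re_inner_le_norm (𝕜 := ℂ) w x
  have h3 := mul_nonneg ht (hR w)
  change (inner ℂ w x).re ≤ _ at h2
  by_contra hc
  nlinarith [norm_nonneg w, norm_nonneg x]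

/-- For x = w + tRw accretivity gives ‖x‖² ≥ ‖w‖² + t²‖Rw‖². So t‖Rw‖ ≤ ‖x‖ and ‖Rw‖ ≤ ‖R‖‖x‖; add
the two bounds. -/
theorem norm_resolv_le {t : ℝ} (ht : 0 ≤ t) : ‖resolv R t‖ ≤ (‖R‖ + 1) * (1 + t)⁻¹ := by
  refine ContinuousLinearMap.opNorm_le_bound _ (by positivity) fun x => ?_
  rw [mul_assoc, mul_comm (1 + t)⁻¹, ← mul_assoc, ← div_eq_mul_inv, le_div_iff₀ (by positivity)]
  have h := inverse_add_smul_apply hR ht x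
  have hle := norm_inverse_apply_le hR ht x
  change ‖R (Ring.inverse (1 + t • R) x)‖ * (1 + t) ≤ _
  set w := Ring.inverse (1 + t • R) x
  have h1 := re_inner_add_smul (R := R) w t
  have h2 := norm_add_sq (𝕜 := ℂ) w (t • R w)
  have h3 : (inner ℂ w (t • R w)).re = t * (inner ℂ w (R w)).re := by
    rw [← Complex.coe_smul, inner_smul_right, Complex.re_ofReal_mul]
  change _ = _ + 2 * (inner ℂ w (t • R w)).re + _ at h2
  rw [h, h3] at h2
  have h4 := mul_nonneg ht (hR w)
  have h5 : ‖t • R w‖ ≤ ‖x‖ := by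
    refine le_of_sq_le_sq ?_ (norm_nonneg x)
    nlinarith [sq_nonneg ‖w‖]
  rw [norm_smul, Real.norm_of_nonneg ht] at h5
  have h6 : ‖R w‖ ≤ ‖R‖ * ‖x‖ :=
    (R.le_opNorm w).trans (mul_le_mul_of_nonneg_left hle (norm_nonneg _))
  linarith

theorem isResolventFamily_resolv : IsResolventFamily (resolv R) (‖R‖ + 1) where
  nonneg := by positivity
  norm_le t ht := norm_resolv_le hR ht
  resolvent_eq s t hs ht := by
    have h1 := Ring.inverse_mul_cancel _ (isUnit_one_add_smul hR hs)
    have h2 := Ring.mul_inverse_cancel _ (isUnit_one_add_smul hR ht)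
    simp only [resolv]
    set V := Ring.inverse (1 + s • R)
    set W := Ring.inverse (1 + t • R)
    have h3 : V - W = (t - s) • (V * R * W) := by
      calc V - W = V * ((1 + t • R) * W) - V * (1 + s • R) * W := by
            rw [h1, h2, mul_one, one_mul]
        _ = V * ((1 + t • R) - (1 + s • R)) * W := by
            rw [mul_sub, sub_mul, mul_assoc V (1 + t • R)]
        _ = V * ((t - s) • R) * W := by
            rw [add_sub_add_left_eq_sub, ← sub_smul]
        _ = _ := by rw [mul_smul_comm, smul_mul_assoc]
    rw [← mul_sub, h3, mul_smul_comm]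
    simp only [mul_assoc]

theorem resolv_zero : resolv R 0 = R := by
  rw [resolv, zero_smul, add_zero, Ring.inverse_one, mul_one]

theorem commute_rootOp : Commute R (rootOp R) := by
  have h := (isResolventFamily_resolv hR).commute_integral le_rfl le_rfl
  rw [resolv_zero hR] at h
  exact h.smul_right _

theorem rootOp_mul_self (hinj : Function.Injective R) : rootOp R * rootOp R = R := by
  have h := (isResolventFamily_resolv hR).integral_mul_self_mul_eq
  rw [resolv_zero hR] at h
  have hpi := Real.pi_ne_zero
  have h1 : rootOp R * rootOp R * (R * R) = R * (R * R) := by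
    rw [rootOp, smul_mul_smul_comm, smul_mul_assoc, h, smul_smul]
    have : 2 / Real.pi * (2 / Real.pi) * (Real.pi / 2) ^ 2 = 1 := by field_simp
    rw [this, one_smul]
  have hc := commute_rootOp hR
  -- With R² moved to the left, injectivity of R cancels it.
  have h2 : R * R * (rootOp R * rootOp R) = R * R * R := by
    rw [((hc.mul_right hc).mul_left (hc.mul_right hc)).eq, h1, mul_assoc]
  ext x
  have h3 := DFunLike.congr_fun h2 x
  exact hinj (hinj h3)

/-- The integrand is nonnegative: with x = w + tRw, Re (Rw, x) = Re (Rw, w) + t‖Rw‖². -/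
theorem re_inner_rootOp_nonneg (x : H) : 0 ≤ (inner ℂ x (rootOp R x)).re := by
  let φ : (H →L[ℂ] H) →L[ℝ] ℝ := Complex.reCLM.comp
    (((innerSL ℂ x).comp (ContinuousLinearMap.apply ℂ H x)).restrictScalars ℝ)
  have hφ : ∀ T : H →L[ℂ] H, φ T = (inner ℂ x (T x)).re := fun T => rfl
  rw [← hφ, rootOp, map_smul,
    ← φ.integral_comp_comm ((isResolventFamily_resolv hR).integrableOn le_rfl)]
  refine smul_nonneg (by positivity) (integral_nonneg fun l => ?_)
  have hl : 0 ≤ l ^ 2 + 0 := by positivity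
  simp only [Pi.zero_apply]
  rw [hφ]
  have h := inverse_add_smul_apply hR hl x
  change 0 ≤ (inner ℂ x (R ((Ring.inverse (1 + (l ^ 2 + 0) • R) : H →L[ℂ] H) x))).re
  set w := (Ring.inverse (1 + (l ^ 2 + 0) • R) : H →L[ℂ] H) x
  rw [← h, inner_add_left, ← Complex.coe_smul, inner_smul_left, Complex.conj_ofReal,
    Complex.add_re, Complex.re_ofReal_mul]
  exact add_nonneg (hR w) (mul_nonneg hl (inner_self_nonneg (𝕜 := ℂ) (x := R w)))

theorem rootOp_apply (x : H) :
    rootOp R x = (2 / Real.pi) • ∫ l in Set.Ioi (0 : ℝ), resolv R (l ^ 2 + 0) x := by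
  rw [rootOp, smul_apply, ContinuousLinearMap.integral_apply
    ((isResolventFamily_resolv hR).integrableOn le_rfl)]

/-- Identifies the square root of B* with the inverse of S*. -/
theorem adjoint_rootOp : adjoint (rootOp R) = rootOp (adjoint R) := by
  have h : ∀ t, star (resolv R t) = resolv (star R) t := fun t => by
    rw [resolv, resolv, star_mul, ← Ring.inverse_star, star_add, star_one, star_smul,
      star_trivial]
    exact (commute_inverse_one_add_smul (star R) t).eq.symm
  rw [← ContinuousLinearMap.star_eq_adjoint, ← ContinuousLinearMap.star_eq_adjoint]
  simp only [rootOp, ← h]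
  rw [star_smul, star_trivial]
  congr 1
  exact ((starL' ℝ : (H →L[ℂ] H) ≃L[ℝ] (H →L[ℂ] H)).integral_comp_comm _).symm

theorem re_inner_adjoint_nonneg (x : H) : 0 ≤ (inner ℂ x (adjoint R x)).re := by
  rw [ContinuousLinearMap.adjoint_inner_right, ← inner_conj_symm, Complex.conj_re]
  exact hR x

theorem rootOp_injective (hinj : Function.Injective R) : Function.Injective (rootOp R) := by
  have h : Function.Injective (rootOp R ∘ rootOp R) := by
    have h1 : Function.Injective (rootOp R * rootOp R) := by
      rwa [rootOp_mul_self hR hinj]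
    exact h1
  exact Function.Injective.of_comp h

theorem denseRange_rootOp (hd : DenseRange R) : DenseRange (rootOp R) := by
  refine denseRange_of_injective_adjoint ?_
  rw [adjoint_rootOp hR]
  exact rootOp_injective (re_inner_adjoint_nonneg hR) (injective_adjoint_of_denseRange hd)

end

/-! ### The Balakrishnan integral -/

theorem mem_graph_add {A B : H →ₗ.[ℂ] H} {x z : H} :
    (x, z) ∈ (A + B).graph ↔ ∃ y y', (x, y) ∈ A.graph ∧ (x, y') ∈ B.graph ∧ y + y' = z := by
  simp only [mem_graph_iff_exists]
  constructor
  · rintro ⟨h, hz⟩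
    exact ⟨_, _, ⟨h.1, rfl⟩, ⟨h.2, rfl⟩, hz⟩
  · rintro ⟨_, _, ⟨h, rfl⟩, ⟨h', rfl⟩, hz⟩
    exact ⟨⟨h, h'⟩, hz⟩

theorem mem_graph_smul {A : H →ₗ.[ℂ] H} {c : ℂ} {x z : H} :
    (x, z) ∈ (c • A).graph ↔ ∃ y, (x, y) ∈ A.graph ∧ c • y = z := by
  simp only [mem_graph_iff_exists]
  constructor
  · rintro ⟨h, hz⟩
    exact ⟨_, ⟨h, rfl⟩, hz⟩
  · rintro ⟨_, ⟨h, rfl⟩, hz⟩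
    exact ⟨h, hz⟩

theorem app_eq_of_mem_graph {A : H →ₗ.[ℂ] H} {x y : H} (h : (x, y) ∈ A.graph) :
    app A x = y := by
  obtain ⟨hx, hy⟩ := mem_graph_iff_exists.1 h
  rw [app, dif_pos hx, hy]

section

variable {R : H →L[ℂ] H} (hR : ∀ x, 0 ≤ (inner ℂ x (R x)).re) (hinj : Function.Injective R)

include hR hinj

theorem mem_graph_inverse_bdd_add {t : ℝ} {u v : H} :
    (u, v) ∈ ((bdd R).inverse + (t : ℂ) • bdd (1 : H →L[ℂ] H)).graph ↔
      ∃ w, R w = u ∧ w + t • R w = v := by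
  rw [mem_graph_add]
  simp only [mem_graph_inverse_bdd hinj, mem_graph_smul, mem_graph_bdd]
  constructor
  · rintro ⟨w, _, rfl, ⟨_, rfl, rfl⟩, h⟩
    exact ⟨w, rfl, h⟩
  · rintro ⟨w, rfl, h⟩
    exact ⟨w, _, rfl, ⟨_, rfl, rfl⟩, h⟩

/-- At the vector Rx of dom B, the factor B commutes past the resolvent and cancels R. -/
theorem app_comp_inverse {t : ℝ} (ht : 0 ≤ t) (x : H) :
    app (comp (bdd R).inverse
      ((bdd R).inverse + (t : ℂ) • bdd (1 : H →L[ℂ] H)).inverse) (R x) = resolv R t x := by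
  have hi : Inj ((bdd R).inverse + (t : ℂ) • bdd (1 : H →L[ℂ] H)) := by
    rw [inj_iff]
    intro u hu
    obtain ⟨w, rfl, hw⟩ := (mem_graph_inverse_bdd_add hR hinj).1 hu
    have h := re_inner_add_smul (R := R) w t
    rw [hw, inner_zero_right, Complex.zero_re] at h
    have h1 := mul_nonneg ht (hR w)
    have h2 : ‖w‖ = 0 := by
      have : ‖w‖ ^ 2 = 0 := le_antisymm (by linarith) (sq_nonneg _)
      exact pow_eq_zero_iff two_ne_zero |>.1 this
    rw [norm_eq_zero.1 h2, map_zero]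
  refine app_eq_of_mem_graph (mem_graph_comp.2 ⟨R (resolv R t x), ?_, ?_⟩)
  · rw [mem_graph_inverse hi, mem_graph_inverse_bdd_add hR hinj]
    refine ⟨_, rfl, ?_⟩
    change R _ + t • R (R _) = R x
    rw [← ContinuousLinearMap.map_smul_of_tower, ← map_add]
    exact congrArg R (inverse_add_smul_apply hR ht x)
  · rw [mem_graph_inverse_bdd hinj]

theorem balakrishnan_half_apply (x : H) :
    balakrishnan (1 / 2) (bdd R).inverse (R x) = rootOp R x := by
  have h1 : ∫ t in Set.Ioi (0 : ℝ), ((t ^ ((1 / 2 : ℝ) - 1) : ℝ) : ℂ) •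
      app (comp (bdd R).inverse
        ((bdd R).inverse + (t : ℂ) • bdd (1 : H →L[ℂ] H)).inverse) (R x) =
      ∫ t in Set.Ioi (0 : ℝ), (t ^ ((1 / 2 : ℝ) - 1) : ℝ) • resolv R t x :=
    setIntegral_congr_fun measurableSet_Ioi fun t ht => by
      have ht : 0 < t := ht
      rw [app_comp_inverse hR hinj ht.le, Complex.coe_smul]
  have h2 : ∫ t in Set.Ioi (0 : ℝ), (t ^ ((1 / 2 : ℝ) - 1) : ℝ) • resolv R t x =
      (2 : ℝ) • ∫ l in Set.Ioi (0 : ℝ), resolv R (l ^ 2 + 0) x := by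
    -- Substituting t = l² turns t^(-1/2) dt into 2 dl.
    rw [← integral_comp_rpow_Ioi_of_pos two_pos, ← integral_smul]
    refine setIntegral_congr_fun measurableSet_Ioi fun l hl => ?_
    have hl : 0 < l := hl
    rw [smul_smul, ← Real.rpow_mul hl.le, add_zero, Real.rpow_two]
    congr 1
    norm_num
    rw [Real.rpow_neg_one]
    field_simp
  rw [balakrishnan, h1, h2, rootOp_apply hR, Complex.coe_smul, smul_smul]
  congr 1
  rw [one_div_mul_eq_div, Real.sin_pi_div_two]
  ring

/-- The Balakrishnan pairs are (S(Sx), Sx). They lie in the closed graph {(Sy, y)} and are dense in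
it because S has dense range. -/
theorem sqrt_inverse_bdd (hd : DenseRange R) :
    sqrt (bdd R).inverse = (bdd (rootOp R)).inverse := by
  have hS := rootOp_injective hR hinj
  have hset : {p : H × H | p.1 ∈ (bdd R).inverse.domain ∧
      p.2 = balakrishnan (1 / 2) (bdd R).inverse p.1} =
      {p : H × H | ∃ x, p = (R x, rootOp R x)} := by
    ext ⟨a, b⟩
    simp only [Set.mem_ofPred_eq, Prod.mk.injEq]
    rw [LinearPMap.mem_domain_iff]
    simp only [mem_graph_inverse_bdd hinj]
    constructor
    · rintro ⟨⟨x, rfl⟩, rfl⟩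
      exact ⟨x, rfl, balakrishnan_half_apply hR hinj x⟩
    · rintro ⟨x, rfl, rfl⟩
      exact ⟨⟨x, rfl⟩, (balakrishnan_half_apply hR hinj x).symm⟩
  have hgraph : (Submodule.span ℂ {p : H × H | ∃ x, p = (R x, rootOp R x)}).topologicalClosure =
      (bdd (rootOp R)).inverse.graph := by
    have hSS : ∀ x, rootOp R (rootOp R x) = R x :=
      DFunLike.congr_fun (rootOp_mul_self hR hinj)
    apply le_antisymm
    · refine Submodule.topologicalClosure_minimal _ (Submodule.span_le.2 ?_) ?_
      · rintro _ ⟨x, rfl⟩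
        exact (mem_graph_inverse_bdd hS).2 (hSS x)
      · have : ((bdd (rootOp R)).inverse.graph : Set (H × H)) = {p | rootOp R p.2 = p.1} := by
          ext ⟨a, b⟩
          exact mem_graph_inverse_bdd hS
        rw [this]
        exact isClosed_eq (by fun_prop) (by fun_prop)
    · rintro ⟨a, y⟩ h
      obtain rfl := (mem_graph_inverse_bdd hS).1 h
      refine (denseRange_rootOp hR hd).induction_on (p := fun y => (rootOp R y, y) ∈
        (Submodule.span ℂ {p : H × H | ∃ x, p = (R x, rootOp R x)}).topologicalClosure) y ?_ ?_
      · exact (Submodule.isClosed_topologicalClosure _).preimage (by fun_prop)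
      · intro x
        refine Submodule.le_topologicalClosure _ (Submodule.subset_span ⟨x, ?_⟩)
        rw [hSS]
  rw [sqrt, fracPow, hset, hgraph]
  refine LinearPMap.eq_of_eq_graph (Submodule.toLinearPMap_graph_eq _ fun p hp h0 => ?_)
  exact LinearPMap.graph_fst_eq_zero_snd _ (x := p.1) (x' := p.2) hp h0

end

/-! ### Factorization of an operator with accretive square -/

theorem re_bdd (S : H →L[ℂ] H) : re (bdd S) = bdd ((1 / 2 : ℂ) • (S + adjoint S)) :=
  ext_graph fun x y => by
    rw [re, adjoint_bdd, mem_graph_smul, mem_graph_bdd]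
    simp only [mem_graph_add, mem_graph_bdd]
    constructor
    · rintro ⟨_, ⟨_, _, rfl, rfl, rfl⟩, rfl⟩
      rfl
    · rintro rfl
      exact ⟨_, ⟨_, _, rfl, rfl, rfl⟩, rfl⟩

theorem mem_graph_sub {A B : H →ₗ.[ℂ] H} {x z : H} :
    (x, z) ∈ (A - B).graph ↔ ∃ y y', (x, y) ∈ A.graph ∧ (x, y') ∈ B.graph ∧ y - y' = z := by
  simp only [mem_graph_iff_exists]
  constructor
  · rintro ⟨h, hz⟩
    exact ⟨_, _, ⟨h.1, rfl⟩, ⟨h.2, rfl⟩, hz⟩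
  · rintro ⟨_, _, ⟨h, rfl⟩, ⟨h', rfl⟩, hz⟩
    exact ⟨⟨h, h'⟩, hz⟩

theorem im_bdd (S : H →L[ℂ] H) :
    im (bdd S) = bdd ((1 / (2 * Complex.I)) • (S - adjoint S)) :=
  ext_graph fun x y => by
    rw [im, adjoint_bdd, mem_graph_smul, mem_graph_bdd]
    simp only [mem_graph_sub, mem_graph_bdd]
    constructor
    · rintro ⟨_, ⟨_, _, rfl, rfl, rfl⟩, rfl⟩
      rfl
    · rintro rfl
      exact ⟨_, ⟨_, _, rfl, rfl, rfl⟩, rfl⟩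

/-- A contraction and its adjoint have the same fixed vectors. -/
theorem adjoint_apply_eq_self {Z : H →L[ℂ] H} (hZ : ‖Z‖ ≤ 1) {x : H} (hx : Z x = x) :
    adjoint Z x = x := by
  have h1 : ‖adjoint Z x‖ ≤ ‖x‖ := by
    refine ((adjoint Z).le_opNorm x).trans (mul_le_of_le_one_left (norm_nonneg _) ?_)
    rwa [LinearIsometryEquiv.norm_map]
  have h2 := norm_sub_sq (𝕜 := ℂ) (adjoint Z x) x
  rw [ContinuousLinearMap.adjoint_inner_left, hx, inner_self_eq_norm_sq] at h2
  have h3 : ‖adjoint Z x - x‖ ^ 2 = 0 :=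
    le_antisymm (by nlinarith [norm_nonneg (adjoint Z x)]) (sq_nonneg _)
  exact sub_eq_zero.1 (norm_eq_zero.1 (pow_eq_zero_iff two_ne_zero |>.1 h3))

theorem injective_one_sub_adjoint {Z : H →L[ℂ] H} (hZ : ‖Z‖ ≤ 1)
    (h : Function.Injective (1 - Z : H →L[ℂ] H)) : Function.Injective (1 - adjoint Z : H →L[ℂ] H) := by
  rw [injective_iff_map_eq_zero] at h ⊢
  intro x hx
  have hx' : adjoint Z x = x := (sub_eq_zero.1 hx).symm
  have h1 := adjoint_apply_eq_self (Z := adjoint Z) (by rwa [LinearIsometryEquiv.norm_map]) hx'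
  rw [ContinuousLinearMap.adjoint_adjoint] at h1
  exact h x (sub_eq_zero.2 h1.symm)

theorem injective_one_add_adjoint {Z : H →L[ℂ] H} (hZ : ‖Z‖ ≤ 1)
    (h : Function.Injective (1 + Z : H →L[ℂ] H)) : Function.Injective (1 + adjoint Z : H →L[ℂ] H) := by
  have := injective_one_sub_adjoint (Z := -Z) (by rwa [norm_neg]) (by rwa [sub_neg_eq_add])
  rwa [map_neg, sub_neg_eq_add] at this

/-- If `Re S²` and `Re S` are nonnegative, then `S = P (1 + Z)` with `P = Re S` and a
contraction `Z` such that `P Z = - Z* P`. -/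
theorem exists_factorization {S : H →L[ℂ] H} (hS : Function.Injective S)
    (hacc : ∀ x, 0 ≤ (inner ℂ x (S x)).re) (hsq : ∀ x, 0 ≤ (inner ℂ x (S (S x))).re) :
    ∃ P Z : H →L[ℂ] H, adjoint P = P ∧ Function.Injective P ∧
      (∀ x, 0 ≤ (inner ℂ x (P x)).re) ∧ ‖Z‖ ≤ 1 ∧
      S = P * (1 + Z) ∧ S = (1 - adjoint Z) * P ∧
      adjoint S = P * (1 - Z) ∧ adjoint S = (1 + adjoint Z) * P ∧
      re (bdd S) = bdd P ∧
      Complex.I • comp (bdd P).inverse (im (bdd S)) = bdd Z := by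
  rw [re_bdd, im_bdd]
  set P : H →L[ℂ] H := (1 / 2 : ℂ) • (S + adjoint S) with hP
  set Q : H →L[ℂ] H := (1 / (2 * Complex.I)) • (S - adjoint S) with hQ
  have hIQ : Complex.I • Q = (1 / 2 : ℂ) • (S - adjoint S) := by
    rw [hQ, smul_smul]
    congr 1
    field_simp
  have hadd : S = P + Complex.I • Q := by
    rw [hIQ, hP, ← smul_add, add_add_sub_cancel, ← two_smul ℂ S, smul_smul]
    norm_num
  have hsub : adjoint S = P - Complex.I • Q := by
    rw [hIQ, hP, ← smul_sub, add_sub_sub_cancel, ← two_smul ℂ (adjoint S), smul_smul]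
    norm_num
  have htwo : (starRingEnd ℂ) 2 = 2 := Complex.conj_ofNat 2
  have hPa : adjoint P = P := by
    rw [hP, map_smulₛₗ, map_add, ContinuousLinearMap.adjoint_adjoint, add_comm]
    simp [htwo]
  have hQa : adjoint Q = Q := by
    rw [hQ, map_smulₛₗ, map_sub, ContinuousLinearMap.adjoint_adjoint, ← neg_sub, smul_neg,
      ← neg_smul]
    congr 1
    simp [htwo]
  have hnorm : ∀ x, ‖Q x‖ ≤ ‖P x‖ := by
    intro x
    have h1 : ‖Q x‖ = 1 / 2 * ‖S x - adjoint S x‖ := by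
      change ‖(1 / (2 * Complex.I)) • (S x - adjoint S x)‖ = _
      rw [norm_smul]; simp
    have h2 : ‖P x‖ = 1 / 2 * ‖S x + adjoint S x‖ := by
      change ‖(1 / 2 : ℂ) • (S x + adjoint S x)‖ = _
      rw [norm_smul]; simp
    have h3 := norm_add_sq (𝕜 := ℂ) (S x) (adjoint S x)
    have h4 := norm_sub_sq (𝕜 := ℂ) (S x) (adjoint S x)
    have h5 : 0 ≤ RCLike.re (inner ℂ (S x) (adjoint S x)) := by
      rw [ContinuousLinearMap.adjoint_inner_right, ← inner_conj_symm, RCLike.conj_re]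
      exact hsq x
    rw [h1, h2]
    have h6 : ‖S x - adjoint S x‖ ≤ ‖S x + adjoint S x‖ :=
      le_of_sq_le_sq (by linarith) (norm_nonneg _)
    linarith
  have hPi : Function.Injective P := by
    rw [injective_iff_map_eq_zero]
    intro x hx
    have hq : Q x = 0 := by
      have := hnorm x
      rw [hx, norm_zero] at this
      exact norm_le_zero_iff.1 this
    refine (injective_iff_map_eq_zero S).1 hS x ?_
    rw [hadd]
    change P x + Complex.I • Q x = 0
    rw [hx, hq, smul_zero, add_zero]
  have hPd : DenseRange P := denseRange_of_injective_adjoint (by rwa [hPa])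
  have hPpos : ∀ x, 0 ≤ (inner ℂ x (P x)).re := by
    intro x
    change 0 ≤ (inner ℂ x ((1 / 2 : ℂ) • (S x + adjoint S x))).re
    have h1 : (inner ℂ x (adjoint S x)).re = (inner ℂ x (S x)).re := by
      rw [ContinuousLinearMap.adjoint_inner_right, ← inner_conj_symm, Complex.conj_re]
    have h2 : (1 / 2 : ℂ) = ((1 / 2 : ℝ) : ℂ) := by norm_num
    rw [inner_smul_right, h2, Complex.re_ofReal_mul, inner_add_right, Complex.add_re, h1]
    linarith [hacc x]
  -- The map Px ↦ Qx is contractive on the dense range of P and extends to H.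
  set W : H →L[ℂ] H := (Q : H →ₗ[ℂ] H).extendOfNorm (P : H →ₗ[ℂ] H)
  have hWP : W * P = Q := by
    ext x
    exact LinearMap.extendOfNorm_eq (f := (Q : H →ₗ[ℂ] H)) (e := (P : H →ₗ[ℂ] H)) hPd
      ⟨1, fun x => by rw [one_mul]; exact hnorm x⟩ x
  have hW : ‖W‖ ≤ 1 := LinearMap.opNorm_extendOfNorm_le hPd zero_le_one
    fun x => by rw [one_mul]; exact hnorm x
  have hPW : P * adjoint W = Q := by
    have := congrArg star hWP
    rwa [star_mul, ContinuousLinearMap.star_eq_adjoint, ContinuousLinearMap.star_eq_adjoint,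
      ContinuousLinearMap.star_eq_adjoint, hPa, hQa] at this
  have hZa : adjoint (Complex.I • adjoint W) = -(Complex.I • W) := by
    rw [map_smulₛₗ, ContinuousLinearMap.adjoint_adjoint]
    simp
  refine ⟨P, Complex.I • adjoint W, hPa, hPi, hPpos, ?_, ?_, ?_, ?_, ?_, rfl, ?_⟩
  · rw [norm_smul, Complex.norm_I, one_mul, LinearIsometryEquiv.norm_map]
    exact hW
  · rw [mul_add, mul_one, mul_smul_comm, hPW, ← hadd]
  · rw [hZa, sub_neg_eq_add, add_mul, one_mul, smul_mul_assoc, hWP, ← hadd]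
  · rw [mul_sub, mul_one, mul_smul_comm, hPW, ← hsub]
  · rw [hZa, ← sub_eq_add_neg, sub_mul, one_mul, smul_mul_assoc, hWP, ← hsub]
  · refine ext_graph fun x y => ?_
    rw [mem_graph_smul, mem_graph_bdd]
    simp only [mem_graph_comp, mem_graph_bdd, mem_graph_inverse_bdd hPi]
    constructor
    · rintro ⟨z, ⟨_, rfl, hz⟩, rfl⟩
      rw [← hPW] at hz
      rw [hPi hz]
      rfl
    · rintro rfl
      exact ⟨adjoint W x, ⟨_, rfl, DFunLike.congr_fun hPW x⟩, rfl⟩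

theorem isPosDefSelfAdjoint_inverse_bdd {P : H →L[ℂ] H} (hPa : adjoint P = P)
    (hPi : Function.Injective P) (hpos : ∀ x, 0 ≤ (inner ℂ x (P x)).re) :
    IsPosDefSelfAdjoint (bdd P).inverse := by
  have hPd : DenseRange P := denseRange_of_injective_adjoint (by rwa [hPa])
  refine ⟨?_, (‖P‖ + 1)⁻¹, by positivity, ?_⟩
  · rw [LinearPMap.isSelfAdjoint_def, adjoint_inverse_bdd hPi hPd, hPa]
  · intro f
    have hf := (mem_graph_inverse_bdd hPi).1 (LinearPMap.mem_graph _ f)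
    rw [← hf]
    set g := (bdd P).inverse f
    set s : ℝ := (‖P‖ + 1)⁻¹ with hs
    have hs0 : 0 < s := by positivity
    -- Positivity of P at g − sPg, together with s‖P‖ ≤ 1, yields (Pg, g) ≥ s‖Pg‖². The 1 in s keeps
    -- it positive even for P = 0.
    have h := hpos (g - s • P g)
    have e : (inner ℂ (g - s • P g) (P (g - s • P g))).re =
        (inner ℂ (P g) g).re - 2 * s * ‖P g‖ ^ 2 + s ^ 2 * (inner ℂ (P g) (P (P g))).re := by
      have h1 : inner ℂ g (P (P g)) = inner ℂ (P g) (P g) := by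
        rw [← ContinuousLinearMap.adjoint_inner_left, hPa]
      have h2 : inner ℂ g (P g) = inner ℂ (P g) g := by
        rw [← ContinuousLinearMap.adjoint_inner_left, hPa]
      have h3 : (inner ℂ (P g) (P g)).re = ‖P g‖ ^ 2 := inner_self_eq_norm_sq (𝕜 := ℂ) (P g)
      rw [map_sub, ContinuousLinearMap.map_smul_of_tower, inner_sub_left, inner_sub_right,
        inner_sub_right, ← Complex.coe_smul, ← Complex.coe_smul, inner_smul_left,
        inner_smul_left, inner_smul_right, inner_smul_right, Complex.conj_ofReal, h1, h2]
      simp only [Complex.sub_re, Complex.re_ofReal_mul, h3]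
      ring
    rw [e] at h
    have h4 : (inner ℂ (P g) (P (P g))).re ≤ ‖P‖ * ‖P g‖ ^ 2 := by
      refine (re_inner_le_norm (𝕜 := ℂ) (P g) (P (P g))).trans ?_
      have := P.le_opNorm (P g)
      nlinarith [norm_nonneg (P g)]
    have h5 : s * ‖P‖ ≤ 1 := by
      rw [hs, inv_mul_le_iff₀ (by positivity)]
      linarith
    have h6 : s ^ 2 * (inner ℂ (P g) (P (P g))).re ≤ s * ‖P g‖ ^ 2 := by
      calc s ^ 2 * (inner ℂ (P g) (P (P g))).re ≤ s ^ 2 * (‖P‖ * ‖P g‖ ^ 2) :=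
            mul_le_mul_of_nonneg_left h4 (sq_nonneg _)
        _ = (s * ‖P‖) * (s * ‖P g‖ ^ 2) := by ring
        _ ≤ 1 * (s * ‖P g‖ ^ 2) := mul_le_mul_of_nonneg_right h5 (by positivity)
        _ = _ := one_mul _
    linarith

/-! ### Cayley transforms of contractions -/

/-- The witness is y = (x + z)/2. This lets the factors of the Cayley transform be interchanged and
describes its graph by a closed equation. -/
theorem cayley_iff {Z : H →L[ℂ] H} {x z : H} :
    (1 + Z) z = (1 - Z) x ↔ ∃ y, (1 + Z) y = x ∧ (1 - Z) y = z := by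
  change z + Z z = x - Z x ↔ ∃ y, y + Z y = x ∧ y - Z y = z
  constructor
  · intro h
    refine ⟨(1 / 2 : ℂ) • (x + z), ?_, ?_⟩
    · rw [map_smul, map_add, ← smul_add,
        show x + z + (Z x + Z z) = x + (z + Z z) + Z x by abel, h,
        show x + (x - Z x) + Z x = x + x by abel, ← two_smul ℂ x, smul_smul]
      norm_num
    · rw [map_smul, map_add, ← smul_sub,
        show x + z - (Z x + Z z) = z + (x - Z x) - Z z by abel, ← h,
        show z + (z + Z z) - Z z = z + z by abel, ← two_smul ℂ z, smul_smul]
      norm_num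
  · rintro ⟨y, rfl, rfl⟩
    rw [map_add, map_sub]
    abel

theorem re_inner_cayley (Z : H →L[ℂ] H) (y : H) :
    (inner ℂ ((1 + Z) y) ((1 - Z) y)).re = ‖y‖ ^ 2 - ‖Z y‖ ^ 2 := by
  change (inner ℂ (y + Z y) (y - Z y)).re = _
  rw [inner_sub_right, inner_add_left, inner_add_left, ← inner_conj_symm (Z y) y]
  have h1 : (inner ℂ y y).re = ‖y‖ ^ 2 := inner_self_eq_norm_sq (𝕜 := ℂ) y
  have h2 : (inner ℂ (Z y) (Z y)).re = ‖Z y‖ ^ 2 := inner_self_eq_norm_sq (𝕜 := ℂ) (Z y)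
  simp only [Complex.sub_re, Complex.add_re, Complex.conj_re, h1, h2]
  ring

theorem im_inner_cayley (Z : H →L[ℂ] H) (y : H) :
    (inner ℂ ((1 + Z) y) ((1 - Z) y)).im = -(2 * (inner ℂ y (Z y)).im) := by
  change (inner ℂ (y + Z y) (y - Z y)).im = _
  rw [inner_sub_right, inner_add_left, inner_add_left, ← inner_conj_symm (Z y) y]
  have h1 : (inner ℂ y y).im = 0 := inner_self_im (𝕜 := ℂ) y
  have h2 : (inner ℂ (Z y) (Z y)).im = 0 := inner_self_im (𝕜 := ℂ) (Z y)
  simp only [Complex.sub_im, Complex.add_im, Complex.conj_im, h1, h2]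
  ring

theorem mem_graph_cayley {Z : H →L[ℂ] H} (h : Function.Injective (1 + Z : H →L[ℂ] H)) {x z : H} :
    (x, z) ∈ (comp (bdd (1 - Z)) (bdd (1 + Z)).inverse).graph ↔
      ∃ y, (1 + Z) y = x ∧ (1 - Z) y = z := by
  simp only [mem_graph_comp, mem_graph_inverse_bdd h, mem_graph_bdd]

theorem norm_sq_apply_le {Z : H →L[ℂ] H} (hZ : ‖Z‖ ≤ 1) (y : H) : ‖Z y‖ ^ 2 ≤ ‖y‖ ^ 2 :=
  pow_le_pow_left₀ (norm_nonneg _)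
    ((Z.le_opNorm y).trans (mul_le_of_le_one_left (norm_nonneg _) hZ)) 2

/-- The adjoint is governed by the same equation with Z* for Z, so both accretivity claims are ‖y‖²
− ‖Zy‖² ≥ 0 for a contraction. -/
theorem isMAccretive_cayley {Z : H →L[ℂ] H} (hZ : ‖Z‖ ≤ 1) (h : Function.Injective (1 + Z : H →L[ℂ] H)) :
    IsMAccretive (comp (bdd (1 - Z)) (bdd (1 + Z)).inverse) := by
  have hd : DenseRange (1 + Z : H →L[ℂ] H) := by
    refine denseRange_of_injective_adjoint ?_
    have := injective_one_add_adjoint hZ h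
    rwa [map_add, ← ContinuousLinearMap.star_eq_adjoint 1, star_one]
  refine ⟨?_, ?_, ?_, ?_⟩
  · rw [isAccretive_iff]
    intro x z hxz
    obtain ⟨y, rfl, rfl⟩ := (mem_graph_cayley h).1 hxz
    rw [re_inner_cayley]
    linarith [norm_sq_apply_le hZ y]
  · refine hd.mono ?_
    rintro _ ⟨y, rfl⟩
    exact LinearPMap.mem_domain_iff.2 ⟨_, (mem_graph_cayley h).2 ⟨y, rfl, rfl⟩⟩
  · have : ((comp (bdd (1 - Z)) (bdd (1 + Z)).inverse).graph : Set (H × H)) =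
        {p | (1 + Z) p.2 = (1 - Z) p.1} := by
      ext ⟨x, z⟩
      exact (mem_graph_cayley h).trans cayley_iff.symm
    rw [LinearPMap.IsClosed, this]
    exact isClosed_eq (by fun_prop) (by fun_prop)
  · rw [isAccretive_iff]
    intro v w hvw
    rw [mem_graph_adjoint hd fun x z => mem_graph_cayley h, map_add, map_sub,
      ← ContinuousLinearMap.star_eq_adjoint 1, star_one, cayley_iff] at hvw
    obtain ⟨y, rfl, rfl⟩ := hvw
    rw [re_inner_cayley]
    linarith [norm_sq_apply_le (Z := adjoint Z) (by rwa [LinearIsometryEquiv.norm_map]) y]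

/-! ### The classes `C_H(α)` -/

theorem norm_smul_add_sq (Z : H →L[ℂ] H) (s c : ℝ) (y : H) :
    ‖((s : ℂ) • Z + (Complex.I * (c : ℂ)) • (1 : H →L[ℂ] H)) y‖ ^ 2 =
      s ^ 2 * ‖Z y‖ ^ 2 + c ^ 2 * ‖y‖ ^ 2 + 2 * s * c * (inner ℂ y (Z y)).im := by
  change ‖(s : ℂ) • Z y + (Complex.I * (c : ℂ)) • y‖ ^ 2 = _
  rw [norm_add_sq (𝕜 := ℂ), norm_smul, norm_smul, mul_pow, mul_pow, inner_smul_left,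
    inner_smul_right, ← inner_conj_symm (Z y) y, Complex.conj_ofReal]
  simp only [Complex.norm_real, norm_mul, Complex.norm_I, one_mul, Real.norm_eq_abs, sq_abs]
  have : RCLike.re ((s : ℂ) * (Complex.I * (c : ℂ) * (starRingEnd ℂ) (inner ℂ y (Z y)))) =
      s * c * (inner ℂ y (Z y)).im := by
    change ((s : ℂ) * (Complex.I * (c : ℂ) * (starRingEnd ℂ) (inner ℂ y (Z y)))).re = _
    rw [Complex.re_ofReal_mul, mul_right_comm, mul_comm _ (c : ℂ), Complex.re_ofReal_mul,
      Complex.I_mul_re, Complex.conj_im]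
    ring
  rw [this]
  ring

theorem opNorm_le_one_iff (T : H →L[ℂ] H) : ‖T‖ ≤ 1 ↔ ∀ y, ‖T y‖ ^ 2 ≤ ‖y‖ ^ 2 := by
  refine ⟨fun h y => norm_sq_apply_le h y, fun h => ?_⟩
  refine T.opNorm_le_bound zero_le_one fun y => ?_
  rw [one_mul]
  exact le_of_sq_le_sq (h y) (norm_nonneg _)

/-- Expand ‖(sin α Z ± i cos α) y‖² ≤ (sin² α + cos² α)‖y‖² and divide by sin α cos α. At α = 0 the
condition says that the form of Z is real. -/
theorem classC_iff {Z : H →L[ℂ] H} (hZ : ‖Z‖ ≤ 1) {α : ℝ} (h0 : 0 ≤ α)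
    (h1 : α < Real.pi / 2) :
    ClassC α Z ↔ ∀ y, |2 * (inner ℂ y (Z y)).im| ≤ Real.tan α * (‖y‖ ^ 2 - ‖Z y‖ ^ 2) := by
  rcases h0.eq_or_lt with rfl | h0
  · rw [ClassC, if_pos rfl, and_iff_left hZ, ContinuousLinearMap.isSelfAdjoint_iff_isSymmetric,
      LinearMap.isSymmetric_iff_inner_map_self_real]
    simp only [Real.tan_zero, zero_mul, abs_nonpos_iff, mul_eq_zero, OfNat.ofNat_ne_zero,
      false_or, ContinuousLinearMap.coe_coe]
    refine forall_congr' fun y => ?_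
    rw [Complex.conj_eq_iff_im, ← inner_conj_symm, Complex.conj_im, neg_eq_zero]
  · rw [ClassC, if_neg h0.ne', opNorm_le_one_iff, opNorm_le_one_iff, ← forall_and]
    refine forall_congr' fun y => ?_
    have hs : 0 < Real.sin α := Real.sin_pos_of_pos_of_lt_pi h0 (by linarith [Real.pi_pos])
    have hc : 0 < Real.cos α := Real.cos_pos_of_mem_Ioo ⟨by linarith, h1⟩
    have e1 := norm_smul_add_sq Z (Real.sin α) (Real.cos α) y
    have e2 := norm_smul_add_sq Z (Real.sin α) (-Real.cos α) y
    rw [Complex.ofReal_neg, mul_neg, neg_smul, ← sub_eq_add_neg] at e2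
    rw [e1, e2, abs_le, Real.tan_eq_sin_div_cos]
    have hsc := Real.sin_sq_add_cos_sq α
    set s := Real.sin α
    set c := Real.cos α
    set m := (inner ℂ y (Z y)).im
    have key : ∀ r : ℝ, (2 * r ≤ s / c * (‖y‖ ^ 2 - ‖Z y‖ ^ 2) ↔
        s ^ 2 * ‖Z y‖ ^ 2 + c ^ 2 * ‖y‖ ^ 2 + 2 * s * c * r ≤ ‖y‖ ^ 2) := by
      intro r
      have hy : ‖y‖ ^ 2 = s ^ 2 * ‖y‖ ^ 2 + c ^ 2 * ‖y‖ ^ 2 := by rw [← add_mul, hsc, one_mul]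
      rw [div_mul_eq_mul_div, le_div_iff₀ hc, ← mul_le_mul_iff_right₀ hs]
      constructor <;> intro h <;> nlinarith
    rw [← key m, neg_sq, show 2 * s * -c * m = 2 * s * c * -m by ring, ← key (-m)]
    constructor
    · rintro ⟨a, b⟩
      exact ⟨by linarith, a⟩
    · rintro ⟨a, b⟩
      exact ⟨b, by linarith⟩

theorem classC_adjoint {Z : H →L[ℂ] H} {α : ℝ} (h : ClassC α Z) : ClassC α (adjoint Z) := by
  rw [ClassC] at h ⊢
  split_ifs at h ⊢ with hα
  · rw [h.1.adjoint_eq]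
    exact h
  · have e : ∀ s c : ℝ, ‖(s : ℂ) • adjoint Z + (Complex.I * (c : ℂ)) • (1 : H →L[ℂ] H)‖ =
        ‖(s : ℂ) • Z - (Complex.I * (c : ℂ)) • (1 : H →L[ℂ] H)‖ := by
      intro s c
      rw [← norm_star, ← ContinuousLinearMap.star_eq_adjoint]
      congr 1
      simp [star_smul, sub_eq_add_neg]
    have e' := e (Real.sin α) (-Real.cos α)
    rw [Complex.ofReal_neg, mul_neg, neg_smul, ← sub_eq_add_neg, sub_neg_eq_add] at e'
    rw [e, e']
    exact ⟨h.2, h.1⟩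

theorem isMSectorial_iff {A : H →ₗ.[ℂ] H} (hA : IsMAccretive A) {α : ℝ} :
    IsMSectorial α A ↔ ∀ x y, (x, y) ∈ A.graph →
      |(inner ℂ x y).im| ≤ Real.tan α * (inner ℂ x y).re := by
  rw [IsMSectorial, and_iff_right hA]
  simp only [mem_graph_iff_exists]
  constructor
  · rintro h x _ ⟨hx, rfl⟩
    exact h ⟨x, hx⟩
  · rintro h ⟨x, hx⟩
    exact h x _ ⟨hx, rfl⟩

/-! ### Sectoriality -/

theorem isMSectorial_cayley_iff {Z : H →L[ℂ] H} (hZ : ‖Z‖ ≤ 1)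
    (h : Function.Injective (1 + Z : H →L[ℂ] H)) {α : ℝ} (h0 : 0 ≤ α) (h1 : α < Real.pi / 2) :
    IsMSectorial α (comp (bdd (1 - Z)) (bdd (1 + Z)).inverse) ↔ ClassC α Z := by
  rw [isMSectorial_iff (isMAccretive_cayley hZ h), classC_iff hZ h0 h1]
  constructor
  · intro hs y
    have := hs _ _ ((mem_graph_cayley h).2 ⟨y, rfl, rfl⟩)
    rwa [im_inner_cayley, re_inner_cayley, abs_neg] at this
  · intro hs x z hxz
    obtain ⟨y, rfl, rfl⟩ := (mem_graph_cayley h).1 hxz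
    rw [im_inner_cayley, re_inner_cayley, abs_neg]
    exact hs y

/-- Moving P and 1 + Z across the inner product turns the form of the operator into the Cayley form
of Z* at Pw. The resulting inequality is closed in y = Pw, hence extends from the dense range of P
to H. -/
theorem isMSectorial_inverse_bdd_iff {P Z : H →L[ℂ] H} (hPa : adjoint P = P)
    (hPi : Function.Injective P) (hZ : ‖Z‖ ≤ 1)
    (hR : Function.Injective (P * (1 + Z) * ((1 - adjoint Z) * P) : H →L[ℂ] H))
    (hB : IsMAccretive (bdd (P * (1 + Z) * ((1 - adjoint Z) * P))).inverse)
    {α : ℝ} (h0 : 0 ≤ α) (h1 : α < Real.pi / 2) :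
    IsMSectorial α (bdd (P * (1 + Z) * ((1 - adjoint Z) * P))).inverse ↔ ClassC α Z := by
  have hPd : DenseRange P := denseRange_of_injective_adjoint (by rwa [hPa])
  have hZ' : ‖adjoint Z‖ ≤ 1 := by rwa [LinearIsometryEquiv.norm_map]
  have hinner : ∀ w, inner ℂ ((P * (1 + Z) * ((1 - adjoint Z) * P)) w) w =
      (starRingEnd ℂ) (inner ℂ ((1 + adjoint Z) (P w)) ((1 - adjoint Z) (P w))) := by
    intro w
    have e : (1 + adjoint Z : H →L[ℂ] H) = adjoint (1 + Z) := by
      rw [map_add, ← ContinuousLinearMap.star_eq_adjoint 1, star_one]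
    change inner ℂ (P ((1 + Z) ((1 - adjoint Z) (P w)))) w = _
    rw [← ContinuousLinearMap.adjoint_inner_right, hPa, e,
      ContinuousLinearMap.adjoint_inner_left, inner_conj_symm]
  have hiff : ClassC α Z ↔ ClassC α (adjoint Z) :=
    ⟨classC_adjoint, fun h => by
      have := classC_adjoint h
      rwa [ContinuousLinearMap.adjoint_adjoint] at this⟩
  rw [isMSectorial_iff hB, hiff, classC_iff hZ' h0 h1]
  have hform : ∀ w, (|(inner ℂ ((P * (1 + Z) * ((1 - adjoint Z) * P)) w) w).im| ≤ Real.tan α *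
      (inner ℂ ((P * (1 + Z) * ((1 - adjoint Z) * P)) w) w).re) ↔
      |2 * (inner ℂ (P w) (adjoint Z (P w))).im| ≤
        Real.tan α * (‖P w‖ ^ 2 - ‖adjoint Z (P w)‖ ^ 2) := by
    intro w
    rw [hinner, Complex.conj_im, Complex.conj_re, im_inner_cayley, re_inner_cayley, neg_neg]
  constructor
  · intro h y
    refine hPd.induction_on (p := fun y => |2 * (inner ℂ y (adjoint Z y)).im| ≤
      Real.tan α * (‖y‖ ^ 2 - ‖adjoint Z y‖ ^ 2)) y ?_ ?_
    · refine isClosed_le ?_ (by fun_prop)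
      have : Continuous fun y : H => inner ℂ y (adjoint Z y) := by fun_prop
      exact (continuous_const.mul (Complex.continuous_im.comp this)).abs
    · intro w
      exact (hform w).1 (h _ _ ((mem_graph_inverse_bdd hR).2 rfl))
  · intro h x w hxw
    obtain rfl := (mem_graph_inverse_bdd hR).1 hxw
    exact (hform w).2 (h _)

end AccretiveSqrt

end

/-! ### The representation theorem for m-accretive operators with bounded inverse -/

open AccretiveSqrt

theorem mainTheorem4 {H : Type*} [NormedAddCommGroup H] [InnerProductSpace ℂ H] [CompleteSpace H]
    (B : H →ₗ.[ℂ] H) (hB : AccretiveSqrt.IsMAccretive B)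
    (hinv : AccretiveSqrt.HasBoundedInverse B) :
    open AccretiveSqrt in
    -- all inverses used in the definition of `𝓛` and of `Z` exist
    (Inj (sqrt B) ∧ Inj (sqrt B.adjoint) ∧ Inj (re (sqrt B).inverse)) ∧
    -- `𝓛` is positive definite and selfadjoint
    IsPosDefSelfAdjoint (opL B) ∧
    -- `Z` is an everywhere defined contraction
    ∃ Z : H →L[ℂ] H, opZ B = bdd Z ∧ ‖Z‖ ≤ 1 ∧
      -- `𝓛 Z* f = - Z 𝓛 f` for all `f ∈ dom 𝓛`
      (∀ f : (opL B).domain, ∃ h : ContinuousLinearMap.adjoint Z (f : H) ∈ (opL B).domain,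
        opL B ⟨ContinuousLinearMap.adjoint Z (f : H), h⟩ = -Z (opL B f)) ∧
      -- the inverses of `I ± Z` and `I ± Z*` exist
      (Inj (bdd (1 + Z)) ∧ Inj (bdd (1 - Z)) ∧
        Inj (bdd (1 + ContinuousLinearMap.adjoint Z)) ∧
        Inj (bdd (1 - ContinuousLinearMap.adjoint Z))) ∧
      -- (1) the representations of `B`
      (B = comp (opL B)
          (comp (bdd ((1 + Z) * (1 - ContinuousLinearMap.adjoint Z))).inverse (opL B)) ∧
        B = comp (bdd (1 + Z)).inverse
          (comp (comp (opL B) (opL B)) (bdd (1 - ContinuousLinearMap.adjoint Z)).inverse)) ∧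
      -- (2) the representations of the square roots of `B` and `B*`
      (sqrt B = comp (bdd (1 + Z)).inverse (opL B) ∧
        sqrt B = comp (opL B) (bdd (1 - ContinuousLinearMap.adjoint Z)).inverse ∧
        sqrt B.adjoint = comp (bdd (1 - Z)).inverse (opL B) ∧
        sqrt B.adjoint = comp (opL B) (bdd (1 + ContinuousLinearMap.adjoint Z)).inverse) ∧
      -- (3) the operator `B^(1/2) B^(*-1/2)`
      (IsMAccretive (comp (sqrt B) (sqrt B.adjoint).inverse) ∧
        comp (sqrt B) (sqrt B.adjoint).inverse = comp (bdd (1 - Z)) (bdd (1 + Z)).inverse) ∧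
      -- (4) the characterization of sectoriality
      (∀ α : ℝ, 0 ≤ α → α < Real.pi / 2 →
        [IsMSectorial α B,
          IsMSectorial α (comp (sqrt B) (sqrt B.adjoint).inverse),
          ClassC α Z].TFAE) := by
  obtain ⟨R, hinj, rfl⟩ := exists_eq_inverse_bdd hinv
  have hR : ∀ x, 0 ≤ (inner ℂ x (R x)).re := by
    intro x
    have h := isAccretive_iff.1 hB.1 (R x) x ((mem_graph_inverse_bdd hinj).2 rfl)
    rwa [← inner_conj_symm, Complex.conj_re] at h
  have hd : DenseRange R := by
    refine hB.2.1.mono ?_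
    intro x hx
    obtain ⟨y, hy⟩ := LinearPMap.mem_domain_iff.1 hx
    exact ⟨y, (mem_graph_inverse_bdd hinj).1 hy⟩
  have hR' := re_inner_adjoint_nonneg hR
  have hinj' := injective_adjoint_of_denseRange hd
  have hd' : DenseRange (ContinuousLinearMap.adjoint R) :=
    denseRange_of_injective_adjoint (by rwa [ContinuousLinearMap.adjoint_adjoint])
  have hS := rootOp_injective hR hinj
  have hS' := rootOp_injective hR' hinj'
  have hSS := rootOp_mul_self hR hinj
  have hsq1 := sqrt_inverse_bdd hR hinj hd
  have hsq2 := sqrt_inverse_bdd hR' hinj' hd'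
  rw [← adjoint_inverse_bdd hinj hd] at hsq2
  rw [← adjoint_rootOp hR] at hsq2 hS'
  obtain ⟨P, Z, hPa, hPi, hpos, hZ, e1, e2, e3, e4, hre, hZdef⟩ :=
    exists_factorization hS (re_inner_rootOp_nonneg hR)
      (fun x => by have := hR x; rwa [← hSS] at this)
  have hL : opL (bdd R).inverse = (bdd P).inverse := by
    rw [opL, hsq1, inverse_inverse_bdd hS, hre]
  have hi1 : Function.Injective (1 + Z : H →L[ℂ] H) := by
    rw [e1] at hS
    exact Function.Injective.of_comp (f := P) hS
  have hi2 : Function.Injective (1 - Z : H →L[ℂ] H) := by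
    rw [e3] at hS'
    exact Function.Injective.of_comp (f := P) hS'
  have hi3 := injective_one_add_adjoint hZ hi1
  have hi4 := injective_one_sub_adjoint hZ hi2
  have hM := injective_mul hi1 hi4
  have hRe1 : R = P * ((1 + Z) * (1 - ContinuousLinearMap.adjoint Z)) * P := by
    rw [← hSS]
    nth_rw 1 [e1]
    rw [e2]
    simp only [mul_assoc]
  have hRe2 : R = (1 - ContinuousLinearMap.adjoint Z) * (P * P) * (1 + Z) := by
    rw [← hSS]
    nth_rw 1 [e2]
    rw [e1]
    simp only [mul_assoc]
  have hRe3 : R = P * (1 + Z) * ((1 - ContinuousLinearMap.adjoint Z) * P) := by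
    rw [hRe1]
    simp only [mul_assoc]
  have hquot : comp (sqrt (bdd R).inverse) (sqrt (bdd R).inverse.adjoint).inverse =
      comp (bdd (1 - Z)) (bdd (1 + Z)).inverse := by
    rw [hsq1, hsq2, inverse_inverse_bdd hS']
    -- The left graph is S z = S* x, that is, P(1 + Z)z = P(1 − Z)x, and P is injective.
    refine ext_graph fun x z => ?_
    rw [mem_graph_cayley hi1, ← cayley_iff, mem_graph_comp]
    simp only [mem_graph_bdd, mem_graph_inverse_bdd hS]
    constructor
    · rintro ⟨_, rfl, h⟩
      rw [e3, e1] at h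
      exact hPi h
    · intro h
      refine ⟨_, rfl, ?_⟩
      rw [e3, e1]
      exact congrArg P h
  refine ⟨⟨?_, ?_, ?_⟩, ?_, Z, ?_, hZ, ?_, ⟨inj_bdd.2 hi1, inj_bdd.2 hi2, inj_bdd.2 hi3,
    inj_bdd.2 hi4⟩, ⟨?_, ?_⟩, ⟨?_, ?_, ?_, ?_⟩, ⟨?_, hquot⟩, ?_⟩
  · rw [hsq1]; exact inj_inverse_bdd hS
  · rw [hsq2]; exact inj_inverse_bdd hS'
  · rw [hsq1, inverse_inverse_bdd hS, hre]; exact inj_bdd.2 hPi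
  · rw [hL]; exact isPosDefSelfAdjoint_inverse_bdd hPa hPi hpos
  · rw [opZ, hsq1, inverse_inverse_bdd hS, hre, hZdef]
  · rw [hL]
    intro f
    have hf := (mem_graph_inverse_bdd hPi).1 (LinearPMap.mem_graph _ f)
    refine mem_graph_iff_exists.1 ((mem_graph_inverse_bdd hPi).2 ?_)
    -- Comparing the two factorizations of S gives PZ = −Z*P, to be applied to the vector that P
    -- sends to f.
    have h := e1.symm.trans e2
    rw [mul_add, sub_mul, mul_one, one_mul, sub_eq_add_neg] at h
    have h2 := DFunLike.congr_fun (add_left_cancel h) ((bdd P).inverse f)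
    change P (Z _) = -(ContinuousLinearMap.adjoint Z (P _)) at h2
    rw [hf] at h2
    rw [map_neg, h2, neg_neg]
  · rw [hL]
    conv_lhs => rw [hRe1]
    rw [inverse_bdd_mul (injective_mul hPi hM) hPi, inverse_bdd_mul hPi hM]
  · rw [hL]
    conv_lhs => rw [hRe2]
    rw [inverse_bdd_mul (injective_mul hi4 (injective_mul hPi hPi)) hi1,
      inverse_bdd_mul hi4 (injective_mul hPi hPi), inverse_bdd_mul hPi hPi]
  · rw [hsq1, hL, e1, inverse_bdd_mul hPi hi1]
  · rw [hsq1, hL, e2, inverse_bdd_mul hi4 hPi]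
  · rw [hsq2, hL, e3, inverse_bdd_mul hPi hi2]
  · rw [hsq2, hL, e4, inverse_bdd_mul hi3 hPi]
  · rw [hquot]; exact isMAccretive_cayley hZ hi1
  · intro α h0 h1
    rw [hquot]
    have h23 := isMSectorial_cayley_iff hZ hi1 h0 h1
    have h13 : IsMSectorial α (bdd R).inverse ↔ ClassC α Z := by
      rw [hRe3] at hB hinj ⊢
      exact isMSectorial_inverse_bdd_iff hPa hPi hZ hinj hB h0 h1
    tfae_have 1 ↔ 3 := h13
    tfae_have 2 ↔ 3 := h23
    tfae_finish
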